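/- Let $1<\alpha<2$. Write $\widehat g$ for the Fourier transform of a tempered distribution $g$ on $\mathbb R^3$, normalized so that $\widehat g(z)=\int_{\mathbb R^3}e^{ix\cdot z}g(x)\,dx$ for $g\in L^1(\mathbb R^3)$, and write $A\asymp B$ on a set if $c^{-1}B\le A\le cB$ there for some constant $c>1$. Let $f$ be a locally integrable real function on $\mathbb R^3$ whose Fourier transform $\widehat f$ is a locally integrable function, such that: 1. $f>0$ on $\mathbb R^3\setminus\{0\}$ and $\widehat f>0$ on $\mathbb R^3$; 2. $f$ is uniformly continuous on $\{\|x\|\ge r\}$ for every $r>0$; 3. $f(x)=\varphi(\|x\|)$ for all $x\neq0$, for some nonincreasing function $\varphi$ on $(0,\infty)$; 4. $f(x)\asymp\|x\|^{-2}[\log(1/\|x\|)]^{-\alpha}$ on $\{0<\|x\|<1/e\}$; 5. $\widehat f(z)\asymp\|z\|^{-1}[\log\|z\|]^{-\alpha}$ on $\{\|z\|\ge e\}$; 6. $\int_{\mathbb R^3}\widehat f(z)\,(1+\|z\|^2)^{-1}\,dz<\infty$. Let $\eta$ be a centered Gaussian noise on $(0,\infty)\times\mathbb R^3$ with $\mathrm{Cov}[\eta(t,x),\eta(s,y)]=\delta_0(t-s)f(x-y)$;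 that is, the Wiener integrals $\int h\,d\eta$, over measurable $h$ with $\int_0^\infty ds\iint|h(s,y)||h(s,y')|f(y-y')\,dy\,dy'<\infty$, form a centered Gaussian process with $\mathrm{Cov}\left[\int h\,d\eta,\int k\,d\eta\right]=\int_0^\infty ds\iint h(s,y)k(s,y')f(y-y')\,dy\,dy'$. Let $$Z(t,x)=1+\int_{(0,t)\times\mathbb R^3}p_{t-s}(y-x)\,\eta(ds\,dy),\qquad p_t(x)=(2\pi t)^{-3/2}e^{-\|x\|^2/(2t)},$$ be the mild solution of $\partial_tZ=\tfrac12\Delta Z+\eta$ with $Z(0)\equiv1$. Then for every $t>0$ there is a finite $K>1$ (depending only on $\alpha$, $f$ and $t$) such that, for every integer $N\ge1$, $$\mathbb P\left\{\max_{j\in\{1,\dots,N\}^3}|Z(t,j/N)|\le\frac1K(\log N)^{1-\alpha/2}\right\}\le\exp\left(-\frac{(\log N)^{2-\alpha}}{K^2(1+t)}\right).$$ -/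

import Mathlib

open MeasureTheory ProbabilityTheory Set
open scoped ENNReal

namespace SHE

/-- Three-dimensional Euclidean space. -/
abbrev E3 : Type := EuclideanSpace ℝ (Fin 3)

/-- `A ≍ B` on `S`: each function is at most a constant multiple of the other, uniformly on `S`. -/
def AsympOn {X : Type*} (S : Set X) (A B : X → ℝ) : Prop :=
  ∃ c : ℝ, 1 < c ∧ ∀ x ∈ S, A x ≤ c * B x ∧ B x ≤ c * A x

/-- The Fourier transform `z ↦ ∫ e^{i x·z} ψ(x) dx` of a Schwartz function. -/
noncomputable def fourierSchwartz (ψ : SchwartzMap E3 ℂ) (z : E3) : ℂ :=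
  ∫ x : E3, Complex.exp (Complex.I * ((inner ℝ x z : ℝ) : ℂ)) * ψ x

/-- The locally integrable function `fhat` is the Fourier transform of the locally integrable
function `f`, in the sense of tempered distributions, with the normalization
`fhat z = ∫ e^{i x·z} f x dx` for integrable `f`. -/
structure IsFourierTransform (f fhat : E3 → ℝ) : Prop where
  locallyIntegrable : LocallyIntegrable f
  locallyIntegrable_hat : LocallyIntegrable fhat
  integrable_mul (ψ : SchwartzMap E3 ℂ) : Integrable fun x => (f x : ℂ) * ψ x
  integrable_hat_mul (ψ : SchwartzMap E3 ℂ) : Integrable fun z => (fhat z : ℂ) * ψ z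
  integral_eq (ψ : SchwartzMap E3 ℂ) :
    ∫ z, (fhat z : ℂ) * ψ z = ∫ x, (f x : ℂ) * fourierSchwartz ψ x

/-- The class of spatial correlation functions `f` with parameter `α`. The functions blow up at the
origin, so the real number `f 0` carries no information and is left unconstrained. -/
structure IsCorrelationFunction (α : ℝ) (f fhat : E3 → ℝ) : Prop where
  fourier : IsFourierTransform f fhat
  pos : ∀ x, x ≠ 0 → 0 < f x
  hat_pos : ∀ z, 0 < fhat z
  uniformContinuousOn : ∀ r : ℝ, 0 < r → UniformContinuousOn f (Metric.ball 0 r)ᶜ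
  radial : ∃ φ : ℝ → ℝ, AntitoneOn φ (Ioi 0) ∧ ∀ x, x ≠ 0 → f x = φ ‖x‖
  asymp : AsympOn (Metric.ball 0 (Real.exp (-1)) \ {0}) f
    fun x => ‖x‖ ^ (-2 : ℝ) * Real.log (1 / ‖x‖) ^ (-α)
  hat_asymp : AsympOn (Metric.ball 0 (Real.exp 1))ᶜ fhat
    fun z => ‖z‖ ^ (-1 : ℝ) * Real.log ‖z‖ ^ (-α)
  dalang : Integrable fun z => fhat z / (1 + ‖z‖ ^ 2)

/-- The admissible deterministic integrands `h` on `(0,∞) × ℝ³` of the Wiener integral: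
measurable, with `∫ ds ∬ |h(s,y)| |h(s,y')| f(y-y') dy dy' < ∞`. -/
def IsIntegrand (f : E3 → ℝ) (h : ℝ × E3 → ℝ) : Prop :=
  Measurable h ∧
    ∫⁻ s in Ioi (0 : ℝ), ∫⁻ y : E3, ∫⁻ y' : E3,
      ENNReal.ofReal (|h (s, y)| * |h (s, y')| * f (y - y')) < ∞

/-- `η` is (the Wiener integral with respect to) a Gaussian noise on `(0,∞) × ℝ³`, white in time
with spatial correlation function `f`, i.e. `Cov[η(t,x), η(s,y)] = δ₀(t-s) f(x-y)`: the random
variables `η h = ∫ h dη`, for `h` an admissible integrand, form a centered Gaussian process with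
covariance `∫ ds ∬ h(s,y) k(s,y') f(y-y') dy dy'`. -/
structure IsNoise {Ω : Type*} [MeasurableSpace Ω] (P : Measure Ω) (f : E3 → ℝ)
    (η : (ℝ × E3 → ℝ) → Ω → ℝ) : Prop where
  isGaussianProcess :
    IsGaussianProcess (fun (h : {h : ℝ × E3 → ℝ // IsIntegrand f h}) => η h.1) P
  centered : ∀ h, IsIntegrand f h → ∫ ω, η h ω ∂P = 0
  covariance : ∀ h k, IsIntegrand f h → IsIntegrand f k →
    cov[η h, η k; P] =
      ∫ s in Ioi (0 : ℝ), ∫ y : E3, ∫ y' : E3, h (s, y) * k (s, y') * f (y - y')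

/-- The heat kernel `p_t(x) = (2πt)^{-3/2} exp(-‖x‖²/(2t))` on `ℝ³`. -/
noncomputable def heatKernel (t : ℝ) (x : E3) : ℝ :=
  (2 * Real.pi * t) ^ (-(3 / 2) : ℝ) * Real.exp (-‖x‖ ^ 2 / (2 * t))

/-- `Z(t,x) = 1 + ∫_{(0,t)×ℝ³} p_{t-s}(y-x) η(ds dy)`, the mild solution of
`∂Z/∂t = ½ΔZ + η` with `Z(0) ≡ 1`. -/
noncomputable def additiveSolution {Ω : Type*} (η : (ℝ × E3 → ℝ) → Ω → ℝ)
    (t : ℝ) (x : E3) (ω : Ω) : ℝ :=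
  1 + η ((Ioo 0 t ×ˢ univ).indicator fun q => heatKernel (t - q.1) (q.2 - x)) ω

/-- The lattice point `j / N` of `ℝ³`. -/
noncomputable def gridPoint (N : ℕ) (j : Fin 3 → Finset.Icc 1 N) : E3 :=
  WithLp.toLp 2 fun i => ((j i : ℕ) : ℝ) / (N : ℝ)

end SHE

/-! Write Z(t,x) - 1 = A(x) + B(x), where B collects the noise of the last ε = N^{-5} units of time.
White noise in time makes the families A and B independent. Put p_r * p_r against f: on the diagonal
this covariance density is of order r⁻¹ (log 1/r)^{-α}, integrable at 0 because α > 1. Hence Var B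
is at least of order (log N)^{1-α} and Var A is bounded, whereas points at distance d ≥ 1/N give
B-covariances O(d⁻³ ε) = O(N⁻²) (`exists_covDensity_le_off`). So B on the grid is a family of n = N³
almost uncorrelated Gaussians of variance δ, and its maximum should have order √(δ log N), at least
of order (log N)^{1-α/2}.

`measureReal_forall_add_le` makes this quantitative despite A. Call a site bad if A ≤ -M. By the
Gaussian tail and Markov's inequality, at least half the sites are bad with probability at most 2
exp(-M²/(2v)). Otherwise, if every A + B is small, the sum of exp(l B - l²δ/2) - 1 over good sites
lies below -n/4. Its mean is 0 and its second moment is o(n²), so Chebyshev's inequality applies.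
Taking M of order lδ with l²δ = (3/2) log N gives the exponent (log N)^{2-α}: the rate comes from a
negative A, not from B.

For the finitely many remaining N a single grid point suffices: |Z| ≤ 1/2 has probability bounded
away from 1, and K absorbs the bounded powers of log N. -/

namespace SHE

/-! ### Gaussian tails and a truncated second-moment method -/

section GaussianTools

variable {Ω : Type*} [MeasurableSpace Ω] {P : Measure Ω}

lemma integrable_exp_mul_of_hasGaussianLaw {X : Ω → ℝ} (hX : HasGaussianLaw X P) (t : ℝ) :
    Integrable (fun ω => Real.exp (t * X ω)) P := by
  have h := integrable_exp_mul_gaussianReal (μ := P[X]) (v := Var[X; P].toNNReal) t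
  rw [← hX.map_eq_gaussianReal] at h
  exact h.comp_aemeasurable hX.aemeasurable

lemma mgf_of_hasGaussianLaw {X : Ω → ℝ} (hX : HasGaussianLaw X P) (h0 : P[X] = 0) (t : ℝ) :
    mgf X P t = Real.exp (Var[X; P] * t ^ 2 / 2) := by
  rw [mgf_gaussianReal hX.map_eq_gaussianReal t, h0, Real.coe_toNNReal _ (variance_nonneg _ _)]
  ring_nf

/-- Chernoff bound for the lower tail of a centered Gaussian variable. -/
lemma measureReal_le_neg_le {X : Ω → ℝ} (hX : HasGaussianLaw X P) (h0 : P[X] = 0) {v M : ℝ}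
    (hv : 0 < v) (hXv : Var[X; P] ≤ v) (hM : 0 ≤ M) :
    P.real {ω | X ω ≤ -M} ≤ Real.exp (-(M ^ 2 / (2 * v))) := by
  have := hX.isProbabilityMeasure
  have hMv : 0 ≤ M / v := by positivity
  -- The parameter `-(M / v)` minimizes tM + vt²/2.
  have h := measure_le_le_exp_mul_mgf (μ := P) (X := X) (t := -(M / v)) (-M) (by linarith)
    (integrable_exp_mul_of_hasGaussianLaw hX _)
  refine h.trans ?_
  rw [mgf_of_hasGaussianLaw hX h0, ← Real.exp_add]
  refine Real.exp_le_exp.2 ?_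
  have h1 : Var[X; P] * (-(M / v)) ^ 2 / 2 ≤ v * (-(M / v)) ^ 2 / 2 := by gcongr
  have h2 : - -(M / v) * -M + v * (-(M / v)) ^ 2 / 2 = -(M ^ 2 / (2 * v)) := by
    field_simp; ring
  linarith

/-- The covariance of the normalized exponentials of two jointly Gaussian variables. -/
lemma integral_exp_sub_one_mul {X Y : Ω → ℝ} [IsProbabilityMeasure P]
    (hXY : HasGaussianLaw (fun ω => (X ω, Y ω)) P) (hX0 : P[X] = 0) (hY0 : P[Y] = 0) {δ : ℝ}
    (hX : Var[X; P] = δ) (hY : Var[Y; P] = δ) (l : ℝ) :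
    Integrable (fun ω => (Real.exp (l * X ω - l ^ 2 * δ / 2) - 1) *
      (Real.exp (l * Y ω - l ^ 2 * δ / 2) - 1)) P ∧
    ∫ ω, (Real.exp (l * X ω - l ^ 2 * δ / 2) - 1) *
      (Real.exp (l * Y ω - l ^ 2 * δ / 2) - 1) ∂P = Real.exp (l ^ 2 * cov[X, Y; P]) - 1 := by
  set c := Real.exp (-(l ^ 2 * δ / 2)) with hc
  have hsum : HasGaussianLaw (X + Y) P := hXY.add
  have iX := integrable_exp_mul_of_hasGaussianLaw hXY.fst l
  have iY := integrable_exp_mul_of_hasGaussianLaw hXY.snd l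
  have iS := integrable_exp_mul_of_hasGaussianLaw hsum l
  have mX := mgf_of_hasGaussianLaw hXY.fst hX0 l
  have mY := mgf_of_hasGaussianLaw hXY.snd hY0 l
  have hS0 : P[X + Y] = 0 := by
    rw [integral_add' hXY.fst.integrable hXY.snd.integrable, hX0, hY0, add_zero]
  have mS := mgf_of_hasGaussianLaw hsum hS0 l
  rw [variance_add hXY.fst.memLp_two hXY.snd.memLp_two, hX, hY] at mS
  rw [hX] at mX
  rw [hY] at mY
  -- The product expands into exponentials of X + Y, X and Y. As Var(X + Y) = 2δ + 2 Cov(X, Y), the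
  -- normalization leaves only exp(l² Cov(X, Y)) from the first.
  have key : ∀ ω, (Real.exp (l * X ω - l ^ 2 * δ / 2) - 1) *
      (Real.exp (l * Y ω - l ^ 2 * δ / 2) - 1) =
      c ^ 2 * Real.exp (l * (X + Y) ω) - c * Real.exp (l * X ω) - c * Real.exp (l * Y ω) + 1 := by
    intro ω
    simp only [Pi.add_apply, mul_add, Real.exp_add, sub_eq_add_neg, ← hc]
    ring
  simp only [key]
  have i1 := iS.const_mul (c ^ 2)
  have i2 := iX.const_mul c
  have i3 := iY.const_mul c
  have i12 : Integrable (fun ω => c ^ 2 * Real.exp (l * (X + Y) ω) - c * Real.exp (l * X ω)) P :=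
    i1.sub i2
  have i123 : Integrable (fun ω => c ^ 2 * Real.exp (l * (X + Y) ω) - c * Real.exp (l * X ω) -
      c * Real.exp (l * Y ω)) P := i12.sub i3
  refine ⟨i123.add (integrable_const 1), ?_⟩
  rw [integral_add i123 (integrable_const 1), integral_sub i12 i3, integral_sub i1 i2]
  simp only [integral_const_mul]
  simp only [mgf] at mX mY mS
  rw [mX, mY, mS, hc]
  simp only [← Real.exp_add, ← Real.exp_nat_mul]
  simp only [integral_const, probReal_univ, smul_eq_mul, mul_one]
  ring_nf
  rw [Real.exp_zero]
  ring

variable [IsProbabilityMeasure P] {ι : Type*} [Fintype ι]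

/-- Second moment of a truncated exponential sum, for two independent Gaussian families. -/
lemma integral_sq_truncated_sum_le {A B : ι → Ω → ℝ} (hG : IsGaussianProcess (Sum.elim A B) P)
    (hB0 : ∀ i, P[B i] = 0) (hAB : ∀ i j, cov[A i, B j; P] = 0) {δ κ : ℝ} (hκ : 0 ≤ κ)
    (hB : ∀ i, Var[B i; P] = δ) (hBB : ∀ i j, i ≠ j → cov[B i, B j; P] ≤ κ)
    {φ : ℝ → ℝ} (hφ : Measurable φ) (hφ0 : ∀ x, 0 ≤ φ x) (hφ1 : ∀ x, φ x ≤ 1) (l : ℝ) :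
    Integrable (fun ω => (∑ i, φ (A i ω) * (Real.exp (l * B i ω - l ^ 2 * δ / 2) - 1)) ^ 2) P ∧
    ∫ ω, (∑ i, φ (A i ω) * (Real.exp (l * B i ω - l ^ 2 * δ / 2) - 1)) ^ 2 ∂P ≤
      Fintype.card ι * Real.exp (l ^ 2 * δ) +
        (Fintype.card ι : ℝ) ^ 2 * (Real.exp (l ^ 2 * κ) - 1) := by
  classical
  have mA : ∀ i, AEMeasurable (A i) P := fun i => hG.aemeasurable (Sum.inl i)
  have mB : ∀ i, AEMeasurable (B i) P := fun i => hG.aemeasurable (Sum.inr i)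
  -- Joint Gaussianity turns vanishing cross-covariances into independence of the whole families, so
  -- the truncation in A factors out of each expectation and costs at most 1.
  have hind := hG.indepFun_of_covariance_eq_zero mA mB hAB
  set ψ : ℝ → ℝ := fun b => Real.exp (l * b - l ^ 2 * δ / 2) - 1 with hψ
  have hψm : Measurable ψ := by fun_prop
  have hpair : ∀ i j, HasGaussianLaw (fun ω => (B i ω, B j ω)) P := fun i j =>
    hG.hasGaussianLaw_prodMk (s := Sum.inr i) (t := Sum.inr j)
  have hE : ∀ i j, Integrable (fun ω => (φ (A i ω) * φ (A j ω)) * (ψ (B i ω) * ψ (B j ω))) P ∧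
      ∫ ω, (φ (A i ω) * φ (A j ω)) * (ψ (B i ω) * ψ (B j ω)) ∂P ≤
        if i = j then Real.exp (l ^ 2 * δ) else Real.exp (l ^ 2 * κ) - 1 := by
    intro i j
    have hI : IndepFun (fun ω => φ (A i ω) * φ (A j ω)) (fun ω => ψ (B i ω) * ψ (B j ω)) P :=
      hind.comp (φ := fun a : ι → ℝ => φ (a i) * φ (a j))
        (ψ := fun b : ι → ℝ => ψ (b i) * ψ (b j))
        (by fun_prop) (by fun_prop)
    obtain ⟨i2, e2⟩ := integral_exp_sub_one_mul (hpair i j) (hB0 i) (hB0 j) (hB i) (hB j) l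
    have m1 : AEStronglyMeasurable (fun ω => φ (A i ω) * φ (A j ω)) P :=
      ((hφ.comp_aemeasurable (mA i)).mul (hφ.comp_aemeasurable (mA j))).aestronglyMeasurable
    have b0 : ∀ ω, 0 ≤ φ (A i ω) * φ (A j ω) := fun ω => mul_nonneg (hφ0 _) (hφ0 _)
    have b1 : ∀ ω, φ (A i ω) * φ (A j ω) ≤ 1 := fun ω =>
      mul_le_one₀ (hφ1 _) (hφ0 _) (hφ1 _)
    have i1 : Integrable (fun ω => φ (A i ω) * φ (A j ω)) P :=
      Integrable.of_bound m1 1 (.of_forall fun ω => by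
        rw [Real.norm_of_nonneg (b0 ω)]; exact b1 ω)
    refine ⟨hI.integrable_mul i1 i2, ?_⟩
    have hmul := hI.integral_mul_eq_mul_integral m1 i2.aestronglyMeasurable
    simp only [Pi.mul_apply] at hmul
    rw [hmul]
    have p0 : 0 ≤ ∫ ω, φ (A i ω) * φ (A j ω) ∂P := integral_nonneg b0
    have p1 : ∫ ω, φ (A i ω) * φ (A j ω) ∂P ≤ 1 := by
      simpa using integral_mono i1 (integrable_const 1) b1
    have hle : ∫ ω, ψ (B i ω) * ψ (B j ω) ∂P ≤
        if i = j then Real.exp (l ^ 2 * δ) else Real.exp (l ^ 2 * κ) - 1 := by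
      refine e2.le.trans ?_
      split_ifs with hij
      · subst hij
        rw [covariance_self (mB i), hB i]; linarith
      · have := hBB i j hij
        gcongr
    have hY : 0 ≤ if i = j then Real.exp (l ^ 2 * δ) else Real.exp (l ^ 2 * κ) - 1 := by
      split_ifs
      · positivity
      · have : 0 ≤ l ^ 2 * κ := by positivity
        linarith [Real.one_le_exp this]
    calc _ ≤ (∫ ω, φ (A i ω) * φ (A j ω) ∂P) *
        (if i = j then Real.exp (l ^ 2 * δ) else Real.exp (l ^ 2 * κ) - 1) := by gcongr
      _ ≤ _ := mul_le_of_le_one_left hY p1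
  have hsq : ∀ ω, (∑ i, φ (A i ω) * ψ (B i ω)) ^ 2 =
      ∑ i, ∑ j, (φ (A i ω) * φ (A j ω)) * (ψ (B i ω) * ψ (B j ω)) := by
    intro ω
    rw [sq, Finset.sum_mul_sum]
    refine Finset.sum_congr rfl fun i _ => Finset.sum_congr rfl fun j _ => by ring
  change Integrable (fun ω => (∑ i, φ (A i ω) * ψ (B i ω)) ^ 2) P ∧
    ∫ ω, (∑ i, φ (A i ω) * ψ (B i ω)) ^ 2 ∂P ≤ _
  simp only [hsq]
  have hint : ∀ i, Integrable
      (fun ω => ∑ j, (φ (A i ω) * φ (A j ω)) * (ψ (B i ω) * ψ (B j ω))) P :=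
    fun i => integrable_finsetSum _ fun j _ => (hE i j).1
  refine ⟨integrable_finsetSum _ fun i _ => hint i, ?_⟩
  rw [integral_finsetSum _ fun i _ => hint i]
  have h1 : ∀ i, ∫ ω, ∑ j, (φ (A i ω) * φ (A j ω)) * (ψ (B i ω) * ψ (B j ω)) ∂P ≤
      Real.exp (l ^ 2 * δ) + Fintype.card ι * (Real.exp (l ^ 2 * κ) - 1) := by
    intro i
    rw [integral_finsetSum _ fun j _ => (hE i j).1]
    have hk : 0 ≤ Real.exp (l ^ 2 * κ) - 1 := by
      have : 0 ≤ l ^ 2 * κ := by positivity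
      linarith [Real.one_le_exp this]
    calc _ ≤ ∑ j, ((if i = j then Real.exp (l ^ 2 * δ) else 0) + (Real.exp (l ^ 2 * κ) - 1)) := by
          refine Finset.sum_le_sum fun j _ => (hE i j).2.trans ?_
          split_ifs <;> linarith
      _ = _ := by
        rw [Finset.sum_add_distrib, Finset.sum_ite_eq Finset.univ i, if_pos (Finset.mem_univ i)]
        simp only [Finset.sum_const, Finset.card_univ, nsmul_eq_mul]
  calc _ ≤ ∑ _i : ι, (Real.exp (l ^ 2 * δ) + Fintype.card ι * (Real.exp (l ^ 2 * κ) - 1)) :=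
        Finset.sum_le_sum fun i _ => h1 i
    _ = _ := by simp; ring

/-- Lower tail of the maximum of `A i + B i`, where `A` and `B` are independent centered Gaussian
families and the variables `B i` are almost uncorrelated. -/
theorem measureReal_forall_add_le [Nonempty ι] {A B : ι → Ω → ℝ} (hG : IsGaussianProcess (Sum.elim A B) P)
    (hA0 : ∀ i, P[A i] = 0) (hB0 : ∀ i, P[B i] = 0) (hAB : ∀ i j, cov[A i, B j; P] = 0)
    {δ κ v l M : ℝ} (hκ : 0 ≤ κ) (hv : 0 < v) (hA : ∀ i, Var[A i; P] ≤ v)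
    (hB : ∀ i, Var[B i; P] = δ) (hBB : ∀ i j, i ≠ j → cov[B i, B j; P] ≤ κ)
    (hl : 0 < l) (hM : 0 ≤ M) :
    P.real {ω | ∀ i, A i ω + B i ω ≤ l * δ / 2 - Real.log 4 / l - M} ≤
      2 * Real.exp (-(M ^ 2 / (2 * v))) +
        16 * (Real.exp (l ^ 2 * δ) / Fintype.card ι + (Real.exp (l ^ 2 * κ) - 1)) := by
  classical
  set n : ℝ := (Fintype.card ι : ℝ) with hn
  have hn0 : 0 < n := by simp [hn, Fintype.card_pos]
  have mA : ∀ i, AEMeasurable (A i) P := fun i => hG.aemeasurable (Sum.inl i)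
  -- φ(A i) marks the good sites, A i > -M; `U` below counts the bad ones.
  set φ : ℝ → ℝ := (Ioi (-M)).indicator 1 with hφ
  have hφm : Measurable φ := measurable_one.indicator measurableSet_Ioi
  have hφ0 : ∀ x, 0 ≤ φ x := fun x => indicator_nonneg (by simp) _
  have hφ1 : ∀ x, φ x ≤ 1 := fun x => by
    rw [hφ, indicator_apply]; split_ifs <;> simp
  obtain ⟨iV, eV⟩ := integral_sq_truncated_sum_le hG hB0 hAB hκ hB hBB hφm hφ0 hφ1 l
  set V : Ω → ℝ := fun ω => ∑ i, φ (A i ω) * (Real.exp (l * B i ω - l ^ 2 * δ / 2) - 1) with hV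
  set U : Ω → ℝ := fun ω => ∑ i, (1 - φ (A i ω)) with hU
  have iφ : ∀ i, Integrable (fun ω => φ (A i ω)) P := fun i =>
    Integrable.of_bound (hφm.comp_aemeasurable (mA i)).aestronglyMeasurable 1
      (.of_forall fun ω => by rw [Real.norm_of_nonneg (hφ0 _)]; exact hφ1 _)
  have iφ' : ∀ i, Integrable (fun ω => 1 - φ (A i ω)) P := fun i =>
    (integrable_const 1).sub (iφ i)
  have iU : Integrable U P := integrable_finsetSum _ fun i _ => iφ' i
  have eU : ∫ ω, U ω ∂P ≤ n * Real.exp (-(M ^ 2 / (2 * v))) := by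
    rw [show ∫ ω, U ω ∂P = ∑ i, ∫ ω, (1 - φ (A i ω)) ∂P from
      integral_finsetSum _ fun i _ => iφ' i]
    have : ∀ i, ∫ ω, (1 - φ (A i ω)) ∂P ≤ Real.exp (-(M ^ 2 / (2 * v))) := by
      intro i
      refine le_trans (le_of_eq ?_) (measureReal_le_neg_le
        (hG.hasGaussianLaw_eval (Sum.inl i)) (hA0 i) hv (hA i) hM)
      have hset : NullMeasurableSet {ω | A i ω ≤ -M} P :=
        nullMeasurableSet_le (mA i) aemeasurable_const
      rw [show P.real {ω | Sum.elim A B (Sum.inl i) ω ≤ -M} = P.real {ω | A i ω ≤ -M} from rfl,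
        show P.real {ω | A i ω ≤ -M} = ∫ ω, {ω | A i ω ≤ -M}.indicator (fun _ => (1 : ℝ)) ω ∂P by
          rw [integral_indicator₀ hset]; simp]
      refine integral_congr_ae (.of_forall fun ω => ?_)
      by_cases h : A i ω ≤ -M
      · simp [hφ, h]
      · simp [hφ, h, not_le.1 h]
    calc _ ≤ ∑ _i : ι, Real.exp (-(M ^ 2 / (2 * v))) := Finset.sum_le_sum fun i _ => this i
      _ = _ := by simp [hn]
  have hsub : {ω | ∀ i, A i ω + B i ω ≤ l * δ / 2 - Real.log 4 / l - M} ⊆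
      {ω | n / 2 ≤ U ω} ∪ {ω | n ^ 2 / 16 ≤ V ω ^ 2} := by
    intro ω hω
    by_contra hcon
    simp only [mem_union, mem_ofPred_eq, not_or, not_le] at hcon hω
    obtain ⟨h1, h2⟩ := hcon
    have h3 : -(n / 4) < V ω := by nlinarith
    have h4 : ∀ i, φ (A i ω) * (Real.exp (l * B i ω - l ^ 2 * δ / 2) - 1) ≤
        -(3 / 4) * φ (A i ω) := by
      intro i
      by_cases h : A i ω ≤ -M
      · simp [hφ, h]
      · have hA' := not_le.1 h
        -- The term log 4 / l in the threshold is there to make the weight at a good site at most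
        -- 1/4.
        have hle : Real.exp (l * B i ω - l ^ 2 * δ / 2) ≤ 1 / 4 := by
          have h5 : B i ω ≤ l * δ / 2 - Real.log 4 / l := by linarith [hω i]
          have h6 : l * B i ω ≤ l * (l * δ / 2 - Real.log 4 / l) := by gcongr
          have h7 : l * (l * δ / 2 - Real.log 4 / l) = l ^ 2 * δ / 2 - Real.log 4 := by
            field_simp
          calc _ ≤ Real.exp (-Real.log 4) := Real.exp_le_exp.2 (by linarith)
            _ = 1 / 4 := by rw [Real.exp_neg, Real.exp_log (by norm_num)]; norm_num
        simp only [hφ, mem_Ioi, hA', indicator_of_mem, Pi.one_apply]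
        linarith
    have h5 : V ω ≤ -(3 / 4) * ∑ i, φ (A i ω) := by
      rw [Finset.mul_sum]; exact Finset.sum_le_sum fun i _ => h4 i
    have h6 : U ω = n - ∑ i, φ (A i ω) := by simp [hU, hn]
    -- With fewer than n/2 bad sites, V ≤ -(3/4)(n/2) = -3n/8, against V > -n/4.
    linarith
  have p1 : P.real {ω | n / 2 ≤ U ω} ≤ 2 * Real.exp (-(M ^ 2 / (2 * v))) := by
    have h := mul_meas_ge_le_integral_of_nonneg (μ := P) (f := U)
      (.of_forall fun ω => Finset.sum_nonneg fun i _ => sub_nonneg.2 (hφ1 _)) iU (n / 2)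
    have h' := h.trans eU
    have : n / 2 * P.real {ω | n / 2 ≤ U ω} ≤ n / 2 * (2 * Real.exp (-(M ^ 2 / (2 * v)))) := by
      linarith
    exact le_of_mul_le_mul_left this (by positivity)
  have p2 : P.real {ω | n ^ 2 / 16 ≤ V ω ^ 2} ≤
      16 * (Real.exp (l ^ 2 * δ) / n + (Real.exp (l ^ 2 * κ) - 1)) := by
    have h := mul_meas_ge_le_integral_of_nonneg (μ := P) (f := fun ω => V ω ^ 2)
      (.of_forall fun ω => sq_nonneg _) iV (n ^ 2 / 16)
    have h' := h.trans eV
    have : n ^ 2 / 16 * P.real {ω | n ^ 2 / 16 ≤ V ω ^ 2} ≤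
        n ^ 2 / 16 * (16 * (Real.exp (l ^ 2 * δ) / n + (Real.exp (l ^ 2 * κ) - 1))) := by
      refine h'.trans (le_of_eq ?_)
      rw [← hn]
      field_simp
    exact le_of_mul_le_mul_left this (by positivity)
  calc _ ≤ P.real ({ω | n / 2 ≤ U ω} ∪ {ω | n ^ 2 / 16 ≤ V ω ^ 2}) := measureReal_mono hsub
    _ ≤ _ := (measureReal_union_le _ _).trans (add_le_add p1 p2)

end GaussianTools

/-! ### Heat kernel estimates -/

section HeatKernel

lemma heatKernel_nonneg (r : ℝ) (hr : 0 ≤ r) (x : E3) : 0 ≤ heatKernel r x := by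
  unfold heatKernel; positivity

lemma heatKernel_neg (r : ℝ) (x : E3) : heatKernel r (-x) = heatKernel r x := by
  simp [heatKernel]

lemma measurable_heatKernel_uncurry : Measurable fun q : ℝ × E3 => heatKernel q.1 q.2 := by
  unfold heatKernel; fun_prop

lemma measurable_heatKernel (r : ℝ) : Measurable (heatKernel r) := by
  unfold heatKernel; fun_prop

/-- The heat kernel with values in `ℝ≥0∞`. -/
noncomputable def heatE (r : ℝ) (x : E3) : ℝ≥0∞ := ENNReal.ofReal (heatKernel r x)

lemma measurable_heatE (r : ℝ) : Measurable (heatE r) :=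
  (measurable_heatKernel r).ennreal_ofReal

lemma heatE_neg (r : ℝ) (x : E3) : heatE r (-x) = heatE r x := by
  simp [heatE, heatKernel_neg]

lemma integral_heatKernel {r : ℝ} (hr : 0 < r) : ∫ x, heatKernel r x = 1 := by
  have h := GaussianFourier.integral_rexp_neg_mul_sq_norm (V := E3) (b := 1 / (2 * r))
    (by positivity)
  simp only [heatKernel]
  rw [integral_const_mul]
  have e : (fun x : E3 => Real.exp (-‖x‖ ^ 2 / (2 * r))) =
      fun x : E3 => Real.exp (-(1 / (2 * r)) * ‖x‖ ^ 2) := by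
    funext x; congr 1; ring
  rw [e, h]
  have : Real.pi / (1 / (2 * r)) = 2 * Real.pi * r := by field_simp
  rw [this, finrank_euclideanSpace_fin, ← Real.rpow_add (by positivity)]
  norm_num

lemma lintegral_heatE {r : ℝ} (hr : 0 < r) : ∫⁻ x, heatE r x = 1 := by
  unfold heatE
  rw [← ofReal_integral_eq_lintegral_ofReal, integral_heatKernel hr, ENNReal.ofReal_one]
  -- A nonintegrable function would have Bochner integral 0, not 1.
  · by_contra h
    have := integral_undef h
    rw [integral_heatKernel hr] at this
    exact one_ne_zero this
  · exact .of_forall fun x => heatKernel_nonneg r hr.le x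

lemma lintegral_heatE_sub {r : ℝ} (hr : 0 < r) (v : E3) : ∫⁻ x, heatE r (x - v) = 1 := by
  rw [lintegral_sub_right_eq_self (heatE r) v, lintegral_heatE hr]

lemma heatE_le {r : ℝ} (hr : 0 < r) (x : E3) :
    heatE r x ≤ ENNReal.ofReal (r ^ (-(3 / 2) : ℝ)) := by
  refine ENNReal.ofReal_le_ofReal ?_
  unfold heatKernel
  have h1 : (2 * Real.pi * r) ^ (-(3 / 2) : ℝ) ≤ r ^ (-(3 / 2) : ℝ) := by
    refine Real.rpow_le_rpow_of_nonpos hr ?_ (by norm_num)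
    nlinarith [Real.pi_gt_three]
  have h2 : Real.exp (-‖x‖ ^ 2 / (2 * r)) ≤ 1 := by
    refine Real.exp_le_one_iff.2 ?_
    rw [neg_div]
    have : 0 ≤ ‖x‖ ^ 2 / (2 * r) := by positivity
    linarith
  calc _ ≤ r ^ (-(3 / 2) : ℝ) * 1 := by gcongr
    _ = _ := mul_one _

/-- Away from the origin the heat kernel is bounded uniformly in time. -/
lemma heatE_le_of_le_norm {r d : ℝ} (hr : 0 < r) (hd : 0 < d) {x : E3} (hx : d ≤ ‖x‖) :
    heatE r x ≤ ENNReal.ofReal (8 * d ^ (-3 : ℝ)) := by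
  refine ENNReal.ofReal_le_ofReal ?_
  unfold heatKernel
  have h1 : (2 * Real.pi * r) ^ (-(3 / 2) : ℝ) ≤ r ^ (-(3 / 2) : ℝ) := by
    refine Real.rpow_le_rpow_of_nonpos hr ?_ (by norm_num)
    nlinarith [Real.pi_gt_three]
  -- In this variable r^{-3/2} = (2y)^{3/2} d⁻³, so a bound uniform in r reduces to y^{3/2} ≤ e^y.
  set y := d ^ 2 / (2 * r) with hy
  have hy0 : 0 < y := by positivity
  have h2 : Real.exp (-‖x‖ ^ 2 / (2 * r)) ≤ Real.exp (-y) := by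
    refine Real.exp_le_exp.2 ?_
    rw [neg_div]
    have : y ≤ ‖x‖ ^ 2 / (2 * r) := by rw [hy]; gcongr
    linarith
  have h3 : y ^ (3 / 2 : ℝ) ≤ Real.exp y := by
    have h4 : y ≤ Real.exp (2 * y / 3) := by
      have := Real.quadratic_le_exp_of_nonneg (x := 2 * y / 3) (by positivity)
      nlinarith [sq_nonneg (y - 3 / 4)]
    calc y ^ (3 / 2 : ℝ) ≤ (Real.exp (2 * y / 3)) ^ (3 / 2 : ℝ) := by gcongr
      _ = Real.exp y := by rw [← Real.exp_mul]; ring_nf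
  have h5 : r = d ^ 2 / (2 * y) := by rw [hy]; field_simp
  have h6 : r ^ (-(3 / 2) : ℝ) = 2 ^ (3 / 2 : ℝ) * y ^ (3 / 2 : ℝ) * d ^ (-3 : ℝ) := by
    rw [h5, Real.div_rpow (by positivity) (by positivity), Real.mul_rpow (by norm_num) hy0.le,
      ← Real.rpow_natCast d 2, ← Real.rpow_mul hd.le, Real.rpow_neg (by norm_num),
      Real.rpow_neg hy0.le]
    have : ((2 : ℕ) : ℝ) * (-(3 / 2)) = -3 := by norm_num
    rw [this]
    field_simp
  have h7 : (2 : ℝ) ^ (3 / 2 : ℝ) ≤ 8 := by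
    calc (2 : ℝ) ^ (3 / 2 : ℝ) ≤ 2 ^ (3 : ℝ) := by gcongr <;> norm_num
      _ = 8 := by norm_num
  calc _ ≤ r ^ (-(3 / 2) : ℝ) * Real.exp (-y) := by gcongr
    _ = 2 ^ (3 / 2 : ℝ) * (y ^ (3 / 2 : ℝ) * Real.exp (-y)) * d ^ (-3 : ℝ) := by rw [h6]; ring
    _ ≤ 8 * (Real.exp y * Real.exp (-y)) * d ^ (-3 : ℝ) := by gcongr
    _ = _ := by rw [← Real.exp_add]; simp

/-- On the diffusive scale √r the kernel is comparable to its maximum; this feeds the lower bound on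
the variance. -/
lemma le_heatE {r : ℝ} (hr : 0 < r) {x : E3} (hx : ‖x‖ ≤ √r) :
    ENNReal.ofReal ((2 * Real.pi * r) ^ (-(3 / 2) : ℝ) * Real.exp (-1)) ≤ heatE r x := by
  refine ENNReal.ofReal_le_ofReal ?_
  unfold heatKernel
  gcongr
  rw [neg_div, neg_le_neg_iff, div_le_one (by positivity)]
  have : ‖x‖ ^ 2 ≤ √r ^ 2 := by gcongr
  rw [Real.sq_sqrt hr.le] at this
  linarith

/-- The integral of `‖x‖⁻²` over a ball of `ℝ³`. -/
lemma lintegral_norm_rpow_ball {ρ : ℝ} (hρ : 0 < ρ) :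
    ∫⁻ x in Metric.ball (0 : E3) ρ, ENNReal.ofReal (‖x‖ ^ (-2 : ℝ)) =
      ENNReal.ofReal (3 * volume.real (Metric.ball (0 : E3) 1) * ρ) := by
  -- In polar coordinates the Jacobian y² cancels y⁻², leaving the integral of 1 over (0, ρ).
  have hy : EqOn (fun y : ℝ => y ^ (Module.finrank ℝ E3 - 1) • y ^ (-2 : ℝ)) (fun _ => (1 : ℝ))
      (Ioi 0) := by
    intro y (hy : 0 < y)
    have h2 : Module.finrank ℝ E3 - 1 = 2 := by simp
    simp only [h2, smul_eq_mul]
    rw [Real.rpow_neg hy.le, Real.rpow_two]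
    field_simp
  have hint : IntegrableOn (fun x : E3 => ‖x‖ ^ (-2 : ℝ)) (Metric.ball 0 ρ) := by
    rw [integrableOn_fun_norm_addHaar volume (f := fun y : ℝ => y ^ (-2 : ℝ)),
      integrableOn_congr_fun (hy.mono Ioo_subset_Ioi_self) measurableSet_Ioo]
    simp
  rw [← ofReal_integral_eq_lintegral_ofReal hint
    (.of_forall fun x => Real.rpow_nonneg (norm_nonneg x) _)]
  congr 1
  have h := integral_fun_norm_addHaar (volume : Measure E3)
    ((Iio ρ).indicator fun y : ℝ => y ^ (-2 : ℝ))
  have e1 : (fun x : E3 => (Iio ρ).indicator (fun y : ℝ => y ^ (-2 : ℝ)) ‖x‖) =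
      (Metric.ball (0 : E3) ρ).indicator fun x => ‖x‖ ^ (-2 : ℝ) := by
    funext x
    simp [indicator]
  rw [e1, integral_indicator Metric.isOpen_ball.measurableSet] at h
  rw [h]
  have e2 : ∫ y in Ioi (0 : ℝ), y ^ (Module.finrank ℝ E3 - 1) •
      (Iio ρ).indicator (fun y : ℝ => y ^ (-2 : ℝ)) y = ρ := by
    have : ∫ y in Ioi (0 : ℝ), y ^ (Module.finrank ℝ E3 - 1) •
        (Iio ρ).indicator (fun y : ℝ => y ^ (-2 : ℝ)) y =
        ∫ y in Ioi (0 : ℝ), (Iio ρ).indicator (fun _ => (1 : ℝ)) y := by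
      refine setIntegral_congr_fun measurableSet_Ioi fun y hy' => ?_
      by_cases hyr : y < ρ
      · simpa [hyr] using hy hy'
      · simp [hyr]
    rw [this, setIntegral_indicator measurableSet_Iio, Ioi_inter_Iio]
    simp [hρ.le]
  rw [e2]
  simp
  ring

end HeatKernel

/-! ### Bounds on the covariance density -/

section Correlation

variable {α : ℝ} {f fhat : E3 → ℝ}

/-- Continuity away from the origin is enough: the uncontrolled value at one point does not affect
measurability. -/
lemma IsCorrelationFunction.measurable (hf : IsCorrelationFunction α f fhat) : Measurable f := by
  refine measurable_of_continuousOn_compl_singleton 0 fun x hx => ?_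
  have hx0 : 0 < ‖x‖ := norm_pos_iff.2 hx
  have h := (hf.uniformContinuousOn (‖x‖ / 2) (by positivity)).continuousOn
  refine (h.continuousAt ?_).continuousWithinAt
  have : {y : E3 | ‖x‖ / 2 < ‖y‖} ∈ nhds x :=
    (isOpen_lt continuous_const continuous_norm).mem_nhds (half_lt_self hx0)
  filter_upwards [this] with y hy
  simpa using (show ‖x‖ / 2 < ‖y‖ from hy).le

lemma IsCorrelationFunction.anti (hf : IsCorrelationFunction α f fhat) {x y : E3} (hx : x ≠ 0)
    (hxy : ‖x‖ ≤ ‖y‖) : f y ≤ f x := by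
  obtain ⟨φ, hφ, h⟩ := hf.radial
  have hx0 : 0 < ‖x‖ := norm_pos_iff.2 hx
  have hy0 : 0 < ‖y‖ := hx0.trans_le hxy
  rw [h x hx, h y (norm_pos_iff.1 hy0)]
  exact hφ hx0 hy0 hxy

/-- The correlation function with values in `ℝ≥0∞`. -/
noncomputable def corrE (f : E3 → ℝ) (x : E3) : ℝ≥0∞ := ENNReal.ofReal (f x)

lemma IsCorrelationFunction.measurable_corrE (hf : IsCorrelationFunction α f fhat) :
    Measurable (corrE f) := hf.measurable.ennreal_ofReal

/-- The profile `ρ ↦ ρ⁻² (-log ρ)^{-α}`. -/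
noncomputable def profile (α ρ : ℝ) : ℝ := ρ ^ (-2 : ℝ) * (-Real.log ρ) ^ (-α)

/-- Supplies a reference point on the sphere of radius ρ, so that radial monotonicity carries the
asymptotics at radius ρ to all points inside or outside that sphere. -/
lemma exists_norm_eq (ρ : ℝ) (hρ : 0 ≤ ρ) : ∃ x : E3, ‖x‖ = ρ :=
  ⟨EuclideanSpace.single 0 ρ, by simp [abs_of_nonneg hρ]⟩

lemma one_lt_neg_log {ρ : ℝ} (h0 : 0 < ρ) (h1 : ρ < Real.exp (-1)) : 1 < -Real.log ρ := by
  have := Real.log_lt_log h0 h1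
  rw [Real.log_exp] at this
  linarith

/-- Two-sided comparison of `f` with the profile. -/
lemma IsCorrelationFunction.exists_bounds (hf : IsCorrelationFunction α f fhat) :
    ∃ c : ℝ, 1 < c ∧
      (∀ x : E3, x ≠ 0 → ‖x‖ < Real.exp (-1) → f x ≤ c * profile α ‖x‖) ∧
      (∀ ρ : ℝ, 0 < ρ → ρ < Real.exp (-1) → ∀ x : E3, ρ ≤ ‖x‖ → f x ≤ c * profile α ρ) ∧
      (∀ ρ : ℝ, 0 < ρ → ρ < Real.exp (-1) → ∀ x : E3, x ≠ 0 → ‖x‖ ≤ ρ →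
        c⁻¹ * profile α ρ ≤ f x) := by
  obtain ⟨c, hc, h⟩ := hf.asymp
  have h' : ∀ x : E3, x ≠ 0 → ‖x‖ < Real.exp (-1) →
      f x ≤ c * profile α ‖x‖ ∧ profile α ‖x‖ ≤ c * f x := by
    intro x hx hx1
    have := h x ⟨by simpa using hx1, hx⟩
    simpa [profile, one_div, Real.log_inv] using this
  refine ⟨c, hc, fun x hx hx1 => (h' x hx hx1).1, ?_, ?_⟩
  · intro ρ h0 h1 x hx
    obtain ⟨y, hy⟩ := exists_norm_eq ρ h0.le
    have hy0 : y ≠ 0 := norm_pos_iff.1 (hy ▸ h0)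
    have := (h' y hy0 (hy ▸ h1)).1
    rw [hy] at this
    exact (hf.anti hy0 (hy ▸ hx)).trans this
  · intro ρ h0 h1 x hx hxρ
    obtain ⟨y, hy⟩ := exists_norm_eq ρ h0.le
    have hy0 : y ≠ 0 := norm_pos_iff.1 (hy ▸ h0)
    have := (h' y hy0 (hy ▸ h1)).2
    rw [hy] at this
    rw [inv_mul_le_iff₀ (by linarith)]
    refine this.trans ?_
    have := hf.anti hx (hy ▸ hxρ)
    gcongr

lemma profile_nonneg {ρ : ℝ} (h0 : 0 ≤ ρ) (h1 : ρ ≤ 1) : 0 ≤ profile α ρ :=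
  mul_nonneg (Real.rpow_nonneg h0 _) (Real.rpow_nonneg (by linarith [Real.log_nonpos h0 h1]) _)

lemma exp_neg_one_lt_one : Real.exp (-1) < 1 := by simp

/-- Mass of `f` near the origin. -/
lemma IsCorrelationFunction.exists_lintegral_ball_le (hf : IsCorrelationFunction α f fhat)
    (hα : 0 < α) :
    ∃ C : ℝ, 0 < C ∧ ∀ ρ : ℝ, 0 < ρ → ρ < Real.exp (-1) →
      ∫⁻ x in Metric.ball (0 : E3) ρ, corrE f x ≤
        ENNReal.ofReal (C * (ρ * (-Real.log ρ) ^ (-α))) := by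
  obtain ⟨c, hc, hup, -, -⟩ := hf.exists_bounds
  have hv : 0 < volume.real (Metric.ball (0 : E3) 1) :=
    ENNReal.toReal_pos (Metric.measure_ball_pos _ _ one_pos).ne' measure_ball_lt_top.ne
  refine ⟨c * (3 * volume.real (Metric.ball (0 : E3) 1)), by positivity, fun ρ h0 h1 => ?_⟩
  have hL := one_lt_neg_log h0 h1
  have hL' : 0 ≤ (-Real.log ρ) ^ (-α) := Real.rpow_nonneg (by linarith) _
  have hpt : ∀ᵐ x ∂(volume.restrict (Metric.ball (0 : E3) ρ)),
      corrE f x ≤ ENNReal.ofReal (c * (-Real.log ρ) ^ (-α)) * ENNReal.ofReal (‖x‖ ^ (-2 : ℝ)) := by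
    have hne : ∀ᵐ x ∂(volume.restrict (Metric.ball (0 : E3) ρ)), x ≠ 0 :=
      ae_restrict_of_ae (compl_mem_ae_iff.2 (measure_singleton 0))
    filter_upwards [hne, ae_restrict_mem Metric.isOpen_ball.measurableSet] with x hx hxb
    have hxρ : ‖x‖ < ρ := by simpa using hxb
    have hx0 : 0 < ‖x‖ := norm_pos_iff.2 hx
    rw [← ENNReal.ofReal_mul (by positivity)]
    refine ENNReal.ofReal_le_ofReal ((hup x hx (hxρ.trans h1)).trans ?_)
    have : (-Real.log ‖x‖) ^ (-α) ≤ (-Real.log ρ) ^ (-α) := by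
      refine Real.rpow_le_rpow_of_nonpos (by linarith) ?_ (by linarith)
      linarith [Real.log_le_log hx0 hxρ.le]
    unfold profile
    calc _ ≤ c * (‖x‖ ^ (-2 : ℝ) * (-Real.log ρ) ^ (-α)) := by gcongr
      _ = _ := by ring
  calc _ ≤ ∫⁻ x in Metric.ball (0 : E3) ρ, ENNReal.ofReal (c * (-Real.log ρ) ^ (-α)) *
        ENNReal.ofReal (‖x‖ ^ (-2 : ℝ)) := lintegral_mono_ae hpt
    _ = _ := by
      rw [lintegral_const_mul' _ _ ENNReal.ofReal_ne_top, lintegral_norm_rpow_ball h0,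
        ← ENNReal.ofReal_mul (by positivity)]
      congr 1; ring

/-- A uniform bound for `p_r * f`. -/
lemma IsCorrelationFunction.exists_lintegral_heatE_mul_le (hf : IsCorrelationFunction α f fhat)
    (hα : 0 < α) :
    ∃ C : ℝ, 0 < C ∧ ∀ r : ℝ, 0 < r → ∀ ρ : ℝ, 0 < ρ → ρ < Real.exp (-1) → ∀ v : E3,
      ∫⁻ w, heatE r (w - v) * corrE f w ≤
        ENNReal.ofReal (C * ((r ^ (-(3 / 2) : ℝ) * ρ + ρ ^ (-2 : ℝ)) * (-Real.log ρ) ^ (-α))) := by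
  obtain ⟨C, hC, hball⟩ := hf.exists_lintegral_ball_le hα
  obtain ⟨c, hc, -, hup, -⟩ := hf.exists_bounds
  refine ⟨C + c, by positivity, fun r hr ρ h0 h1 v => ?_⟩
  have hL := one_lt_neg_log h0 h1
  have hL' : 0 ≤ (-Real.log ρ) ^ (-α) := Real.rpow_nonneg (by linarith) _
  have hm : Measurable fun w => heatE r (w - v) := (measurable_heatE r).comp (by fun_prop)
  -- Split at radius ρ: inside, the kernel is at most r^{-3/2} and f has small mass; outside, f is
  -- at most its profile at ρ and the kernel has mass 1.
  rw [← lintegral_add_compl _ (Metric.isOpen_ball (x := (0 : E3)) (ε := ρ)).measurableSet]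
  have i1 : ∫⁻ w in Metric.ball (0 : E3) ρ, heatE r (w - v) * corrE f w ≤
      ENNReal.ofReal (r ^ (-(3 / 2) : ℝ) * (C * (ρ * (-Real.log ρ) ^ (-α)))) := by
    calc _ ≤ ∫⁻ w in Metric.ball (0 : E3) ρ, ENNReal.ofReal (r ^ (-(3 / 2) : ℝ)) * corrE f w := by
          gcongr; exact heatE_le hr _
      _ ≤ _ := by
        rw [lintegral_const_mul' _ _ ENNReal.ofReal_ne_top, ENNReal.ofReal_mul (by positivity)]
        gcongr
        exact hball ρ h0 h1
  have i2 : ∫⁻ w in (Metric.ball (0 : E3) ρ)ᶜ, heatE r (w - v) * corrE f w ≤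
      ENNReal.ofReal (c * profile α ρ) := by
    calc _ ≤ ∫⁻ w in (Metric.ball (0 : E3) ρ)ᶜ, heatE r (w - v) *
          ENNReal.ofReal (c * profile α ρ) := by
          refine setLIntegral_mono (hm.mul_const _) fun w hw => ?_
          gcongr
          exact ENNReal.ofReal_le_ofReal (hup ρ h0 h1 w (by simpa using hw))
      _ ≤ ∫⁻ w, heatE r (w - v) * ENNReal.ofReal (c * profile α ρ) := setLIntegral_le_lintegral _ _
      _ = _ := by
        rw [lintegral_mul_const' _ _ ENNReal.ofReal_ne_top, lintegral_heatE_sub hr, one_mul]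
  refine (add_le_add i1 i2).trans ?_
  have hp := profile_nonneg (α := α) h0.le (h1.trans exp_neg_one_lt_one).le
  rw [← ENNReal.ofReal_add (by positivity) (by positivity)]
  refine ENNReal.ofReal_le_ofReal ?_
  have a1 : 0 ≤ c * (r ^ (-(3 / 2) : ℝ) * ρ * (-Real.log ρ) ^ (-α)) := by positivity
  have a2 : 0 ≤ C * (ρ ^ (-2 : ℝ) * (-Real.log ρ) ^ (-α)) := by positivity
  unfold profile
  nlinarith

/-- The covariance density `∬ p_r(u-x) p_r(v-y) f(u-v) du dv`. -/
noncomputable def covDensity (f : E3 → ℝ) (r : ℝ) (x y : E3) : ℝ≥0∞ :=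
  ∫⁻ u, ∫⁻ v, heatE r (u - x) * heatE r (v - y) * corrE f (u - v)

lemma lintegral_heatE_mul_corrE (r : ℝ) (y u : E3) :
    ∫⁻ v, heatE r (v - y) * corrE f (u - v) = ∫⁻ w, heatE r (w - (u - y)) * corrE f w := by
  rw [← lintegral_sub_left_eq_self (fun v => heatE r (v - y) * corrE f (u - v)) u]
  refine lintegral_congr fun w => ?_
  rw [sub_sub_cancel, show u - w - y = -(w - (u - y)) by abel, heatE_neg]

/-- The covariance density averages p_r * f against a probability density, so it is at most any
uniform bound for p_r * f. -/
lemma covDensity_le_of_forall {r : ℝ} (hr : 0 < r) (x y : E3) {C : ℝ≥0∞} (hC : C ≠ ∞)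
    (h : ∀ v : E3, ∫⁻ w, heatE r (w - v) * corrE f w ≤ C) : covDensity f r x y ≤ C := by
  unfold covDensity
  calc _ ≤ ∫⁻ u, heatE r (u - x) * C := by
        refine lintegral_mono fun u => ?_
        simp only [mul_assoc]
        rw [lintegral_const_mul' _ _ (by simp [heatE]), lintegral_heatE_mul_corrE]
        gcongr
        exact h _
    _ = C := by rw [lintegral_mul_const' _ _ hC, lintegral_heatE_sub hr, one_mul]

/-- Upper bound on the covariance density for small times. -/
lemma IsCorrelationFunction.exists_covDensity_le_small (hf : IsCorrelationFunction α f fhat)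
    (hα : 0 < α) :
    ∃ C : ℝ, 0 < C ∧ ∀ r : ℝ, 0 < r → r < Real.exp (-2) → ∀ x y : E3,
      covDensity f r x y ≤ ENNReal.ofReal (C * (r⁻¹ * (-Real.log r) ^ (-α))) := by
  obtain ⟨C, hC, h⟩ := hf.exists_lintegral_heatE_mul_le hα
  refine ⟨C * (2 * (1 / 2) ^ (-α)), by positivity, fun r h0 h1 x y => ?_⟩
  refine covDensity_le_of_forall h0 x y ENNReal.ofReal_ne_top fun v => ?_
  -- The radius ρ = √r balances the two terms: r^{-3/2} ρ = ρ⁻² = r⁻¹.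
  have hs : √r < Real.exp (-1) := by
    rw [Real.sqrt_lt' (Real.exp_pos _), ← Real.exp_nat_mul]
    simpa using h1
  refine (h r h0 (√r) (Real.sqrt_pos.2 h0) hs v).trans (ENNReal.ofReal_le_ofReal (le_of_eq ?_))
  have hlog : 0 ≤ -Real.log r := by
    have := Real.log_lt_log h0 h1
    rw [Real.log_exp] at this
    linarith
  have e1 : r ^ (-(3 / 2) : ℝ) * √r = r⁻¹ := by
    rw [Real.sqrt_eq_rpow, ← Real.rpow_add h0, ← Real.rpow_neg_one]; norm_num
  have e2 : √r ^ (-2 : ℝ) = r⁻¹ := by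
    rw [Real.rpow_neg (Real.sqrt_nonneg _), Real.rpow_two, Real.sq_sqrt h0.le]
  have e3 : -Real.log √r = 1 / 2 * -Real.log r := by rw [Real.log_sqrt h0.le]; ring
  rw [e1, e2, e3, Real.mul_rpow (by norm_num) hlog]
  ring

/-- Upper bound on the covariance density away from time zero. -/
lemma IsCorrelationFunction.exists_covDensity_le_large (hf : IsCorrelationFunction α f fhat)
    (hα : 0 < α) {r₀ : ℝ} (hr₀ : 0 < r₀) :
    ∃ C : ℝ, 0 < C ∧ ∀ r : ℝ, r₀ ≤ r → ∀ x y : E3, covDensity f r x y ≤ ENNReal.ofReal C := by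
  obtain ⟨C, hC, h⟩ := hf.exists_lintegral_heatE_mul_le hα
  have e0 : 0 < Real.exp (-2) := Real.exp_pos _
  -- Away from r = 0 a fixed splitting radius suffices; e⁻² is a convenient one below e⁻¹.
  refine ⟨C * ((r₀ ^ (-(3 / 2) : ℝ) * Real.exp (-2) + Real.exp (-2) ^ (-2 : ℝ)) *
    (-Real.log (Real.exp (-2))) ^ (-α)), ?_, fun r hr x y => ?_⟩
  · rw [Real.log_exp]
    positivity
  · have h0 : 0 < r := hr₀.trans_le hr
    refine covDensity_le_of_forall h0 x y ENNReal.ofReal_ne_top fun v => ?_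
    refine (h r h0 (Real.exp (-2)) e0 (Real.exp_lt_exp.2 (by norm_num)) v).trans
      (ENNReal.ofReal_le_ofReal ?_)
    have : r ^ (-(3 / 2) : ℝ) ≤ r₀ ^ (-(3 / 2) : ℝ) :=
      Real.rpow_le_rpow_of_nonpos hr₀ hr (by norm_num)
    have : 0 ≤ (-Real.log (Real.exp (-2))) ^ (-α) := by rw [Real.log_exp]; positivity
    gcongr

/-- Lower bound on the diagonal covariance density for small times. -/
lemma IsCorrelationFunction.exists_le_covDensity (hf : IsCorrelationFunction α f fhat)
    (hα : 0 < α) :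
    ∃ c : ℝ, 0 < c ∧ ∀ r : ℝ, 0 < r → r < Real.exp (-2) / 4 → ∀ x : E3,
      ENNReal.ofReal (c * (r⁻¹ * (-Real.log r) ^ (-α))) ≤ covDensity f r x x := by
  obtain ⟨c, hc, -, -, hlow⟩ := hf.exists_bounds
  set b := volume.real (Metric.ball (0 : E3) 1) with hb
  have hv : 0 < b :=
    ENNReal.toReal_pos (Metric.measure_ball_pos _ _ one_pos).ne' measure_ball_lt_top.ne
  set q := (2 * Real.pi) ^ (-(3 / 2) : ℝ) * Real.exp (-1) with hq
  have hq0 : 0 < q := by positivity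
  refine ⟨(q * b) ^ 2 * (c⁻¹ * (1 / 4)), by positivity, fun r h0 h1 x => ?_⟩
  -- Keep only u, v in the ball of radius s about x. Each kernel is at least of order s⁻³, each ball
  -- has volume of order s³, and ‖u - v‖ ≤ 2s, so f is at least of the order of its profile at 2s;
  -- the powers of s from kernels and volumes cancel.
  set s := √r with hs
  have hs0 : 0 < s := Real.sqrt_pos.2 h0
  have hs2 : s ^ 2 = r := Real.sq_sqrt h0.le
  have h2s : 2 * s < Real.exp (-1) := by
    have h2 : Real.exp (-1) ^ 2 = Real.exp (-2) := by
      rw [← Real.exp_nat_mul]; norm_num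
    refine lt_of_pow_lt_pow_left₀ 2 (Real.exp_pos _).le ?_
    rw [h2, mul_pow, hs2]; linarith
  have hp := profile_nonneg (α := α) (by positivity) (h2s.trans exp_neg_one_lt_one).le
  have hvol : volume (Metric.ball x s) = ENNReal.ofReal (s ^ 3 * b) := by
    rw [Measure.addHaar_ball _ _ hs0.le, finrank_euclideanSpace_fin, ENNReal.ofReal_mul
      (by positivity), hb, ofReal_measureReal measure_ball_lt_top.ne]
  set m := (2 * Real.pi * r) ^ (-(3 / 2) : ℝ) * Real.exp (-1) with hm
  have hm0 : 0 ≤ m := by positivity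
  have hmq : m = q * r ^ (-(3 / 2) : ℝ) := by
    rw [hm, hq, Real.mul_rpow (by positivity) h0.le]; ring
  set K := ENNReal.ofReal m * ENNReal.ofReal m * ENNReal.ofReal (c⁻¹ * profile α (2 * s)) with hK
  have hpt : ∀ u ∈ Metric.ball x s, ENNReal.ofReal (s ^ 3 * b) * K ≤
      ∫⁻ v, heatE r (u - x) * heatE r (v - x) * corrE f (u - v) := by
    intro u hu
    rw [← hvol, mul_comm, ← setLIntegral_const]
    refine le_trans (lintegral_mono_ae ?_) (setLIntegral_le_lintegral (Metric.ball x s) _)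
    have hne : ∀ᵐ v ∂(volume.restrict (Metric.ball x s)), v ≠ u :=
      ae_restrict_of_ae (compl_mem_ae_iff.2 (measure_singleton u))
    filter_upwards [hne, ae_restrict_mem Metric.isOpen_ball.measurableSet] with v hvu hvb
    have hu' : ‖u - x‖ < s := by simpa [dist_eq_norm] using hu
    have hv' : ‖v - x‖ < s := by simpa [dist_eq_norm] using hvb
    have huv : ‖u - v‖ ≤ 2 * s := by
      calc ‖u - v‖ = ‖(u - x) - (v - x)‖ := by congr 1; abel
        _ ≤ ‖u - x‖ + ‖v - x‖ := norm_sub_le _ _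
        _ ≤ _ := by linarith
    rw [hK]
    gcongr
    · exact le_heatE h0 hu'.le
    · exact le_heatE h0 hv'.le
    · exact ENNReal.ofReal_le_ofReal
        (hlow (2 * s) (by positivity) h2s _ (sub_ne_zero.2 hvu.symm) huv)
  have hbig : ENNReal.ofReal (s ^ 3 * b) * K * ENNReal.ofReal (s ^ 3 * b) ≤ covDensity f r x x := by
    unfold covDensity
    rw [← hvol, ← setLIntegral_const, hvol]
    exact (setLIntegral_mono' Metric.isOpen_ball.measurableSet hpt).trans
      (setLIntegral_le_lintegral _ _)
  refine le_trans ?_ hbig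
  rw [hK, ← ENNReal.ofReal_mul hm0, ← ENNReal.ofReal_mul (by positivity),
    ← ENNReal.ofReal_mul (by positivity), ← ENNReal.ofReal_mul (by positivity)]
  refine ENNReal.ofReal_le_ofReal ?_
  have hs3 : s ^ 3 * r ^ (-(3 / 2) : ℝ) = 1 := by
    rw [hs, Real.sqrt_eq_rpow, ← Real.rpow_natCast, ← Real.rpow_mul h0.le, ← Real.rpow_add h0]
    norm_num
  have hprof : 1 / 4 * (r⁻¹ * (-Real.log r) ^ (-α)) ≤ profile α (2 * s) := by
    unfold profile
    have e1 : (2 * s) ^ (-2 : ℝ) = 1 / 4 * r⁻¹ := by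
      rw [Real.rpow_neg (by positivity), Real.rpow_two, mul_pow, hs2, mul_inv]; norm_num
    have hl := one_lt_neg_log (by positivity) h2s
    have e2 : (-Real.log r) ^ (-α) ≤ (-Real.log (2 * s)) ^ (-α) := by
      refine Real.rpow_le_rpow_of_nonpos (by linarith) ?_ (by linarith)
      have : Real.log r ≤ Real.log (2 * s) := by
        refine Real.log_le_log h0 ?_
        rw [← hs2]
        nlinarith [exp_neg_one_lt_one]
      linarith
    rw [e1]
    calc _ = 1 / 4 * r⁻¹ * (-Real.log r) ^ (-α) := by ring
      _ ≤ _ := by gcongr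
  have hfin : s ^ 3 * b * (m * m * (c⁻¹ * profile α (2 * s))) * (s ^ 3 * b) =
      (q * b) ^ 2 * (c⁻¹ * profile α (2 * s)) := by
    rw [hmq]
    calc _ = (s ^ 3 * r ^ (-(3 / 2) : ℝ)) ^ 2 * ((q * b) ^ 2 * (c⁻¹ * profile α (2 * s))) := by ring
      _ = _ := by rw [hs3]; ring
  rw [hfin]
  calc _ = (q * b) ^ 2 * (c⁻¹ * (1 / 4 * (r⁻¹ * (-Real.log r) ^ (-α)))) := by ring
    _ ≤ _ := by gcongr

/-- Measurability of one summand suffices, as in `lintegral_add_left`; used to separate the three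
terms of the off-diagonal bound. -/
lemma lintegral_lintegral_add {X Y : Type*} [MeasurableSpace X] [MeasurableSpace Y] {μ : Measure X}
    {ν : Measure Y} [SFinite ν] {F : X × Y → ℝ≥0∞} (hF : Measurable F) (G : X × Y → ℝ≥0∞) :
    ∫⁻ x, ∫⁻ y, (F (x, y) + G (x, y)) ∂ν ∂μ =
      (∫⁻ x, ∫⁻ y, F (x, y) ∂ν ∂μ) + ∫⁻ x, ∫⁻ y, G (x, y) ∂ν ∂μ := by
  rw [← lintegral_add_left hF.lintegral_prod_right']
  refine lintegral_congr fun x => ?_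
  exact lintegral_add_left (hF.comp measurable_prodMk_left) fun y => G (x, y)

/-- Off-diagonal bound on the covariance density, uniform in time. -/
lemma IsCorrelationFunction.exists_covDensity_le_off (hf : IsCorrelationFunction α f fhat)
    (hα : 0 < α) :
    ∃ C : ℝ, 0 < C ∧ ∀ d : ℝ, 0 < d → d ≤ 1 / 2 → ∀ r : ℝ, 0 < r → ∀ x y : E3, d ≤ ‖x - y‖ →
      covDensity f r x y ≤ ENNReal.ofReal (C * d ^ (-3 : ℝ)) := by
  obtain ⟨c, hc, -, hup, -⟩ := hf.exists_bounds
  obtain ⟨C, hC, hball⟩ := hf.exists_lintegral_ball_le hα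
  have hquarter : (1 / 4 : ℝ) < Real.exp (-1) := by
    rw [Real.exp_neg, one_div]
    exact inv_strictAnti₀ (Real.exp_pos _) (by linarith [Real.exp_one_lt_d9])
  set I : ℝ := C * (1 / 4 * (-Real.log (1 / 4)) ^ (-α)) with hI
  have hI0 : 0 ≤ I := by
    have := one_lt_neg_log (by norm_num) hquarter
    have : 0 ≤ (-Real.log (1 / 4)) ^ (-α) := Real.rpow_nonneg (by linarith) _
    positivity
  refine ⟨4 * c + 2 * (512 * I), by positivity, fun d hd hd2 r hr x y hxy => ?_⟩
  set G : ℝ≥0∞ := ENNReal.ofReal (4 * c * d ^ (-3 : ℝ)) with hG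
  set D : ℝ≥0∞ := ENNReal.ofReal (512 * d ^ (-3 : ℝ)) with hD
  -- Since d ≤ 1/2, ‖u - v‖ < d/2 forces ‖u - v‖ < 1/4, so this local part of f, of finite mass,
  -- does not depend on d.
  set gb : E3 → ℝ≥0∞ := (Metric.ball (0 : E3) (1 / 4)).indicator (corrE f) with hgb
  have hgbm : Measurable gb := hf.measurable_corrE.indicator Metric.isOpen_ball.measurableSet
  have hgbI : ∫⁻ w, gb w ≤ ENNReal.ofReal I := by
    rw [hgb, lintegral_indicator Metric.isOpen_ball.measurableSet]
    exact hball _ (by norm_num) hquarter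
  have hDle : ∀ w : E3, d / 4 ≤ ‖w‖ → heatE r w ≤ D := by
    intro w hw
    refine (heatE_le_of_le_norm hr (by positivity) hw).trans (ENNReal.ofReal_le_ofReal ?_)
    rw [Real.div_rpow hd.le (by norm_num)]
    have : (4 : ℝ) ^ (-3 : ℝ) = 1 / 64 := by
      rw [Real.rpow_neg (by norm_num)]; norm_num
    rw [this]
    exact le_of_eq (by ring)
  have hGle : ∀ w : E3, d / 2 ≤ ‖w‖ → corrE f w ≤ G := by
    intro w hw
    have hd4 : d / 2 < Real.exp (-1) := by linarith
    refine ENNReal.ofReal_le_ofReal ((hup (d / 2) (by positivity) hd4 w hw).trans ?_)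
    have hl := one_lt_neg_log (by positivity) hd4
    have e1 : (-Real.log (d / 2)) ^ (-α) ≤ 1 :=
      Real.rpow_le_one_of_one_le_of_nonpos hl.le (by linarith)
    have e2 : (d / 2) ^ (-2 : ℝ) = 4 * d ^ (-2 : ℝ) := by
      rw [Real.div_rpow hd.le (by norm_num), Real.rpow_neg (by norm_num : (0:ℝ) ≤ 2)]
      norm_num
      ring
    have e3 : d ^ (-2 : ℝ) ≤ d ^ (-3 : ℝ) :=
      Real.rpow_le_rpow_of_exponent_ge hd (by linarith) (by norm_num)
    unfold profile
    rw [e2]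
    calc _ ≤ c * (4 * d ^ (-3 : ℝ) * 1) := by gcongr
      _ = _ := by ring
  -- As ‖x - y‖ ≥ d, either ‖u - v‖ ≥ d/2, where f ≤ G, or one of ‖u - x‖, ‖v - y‖ is at least d/4,
  -- where that kernel is at most D. In the latter case the other kernel and the local part of f
  -- have finite mass.
  have hpt : ∀ u v : E3, heatE r (u - x) * heatE r (v - y) * corrE f (u - v) ≤
      heatE r (u - x) * heatE r (v - y) * G + D * (heatE r (v - y) * gb (u - v)) +
        D * (heatE r (u - x) * gb (u - v)) := by
    intro u v
    by_cases huv : d / 2 ≤ ‖u - v‖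
    · refine le_trans ?_ (le_add_right (le_add_right le_rfl))
      gcongr
      exact hGle _ huv
    · push Not at huv
      have hg : corrE f (u - v) = gb (u - v) := by
        rw [hgb, indicator_of_mem]
        simp only [Metric.mem_ball, dist_zero_right]
        linarith
      rw [hg]
      have htri : ‖x - y‖ ≤ ‖u - x‖ + ‖u - v‖ + ‖v - y‖ := by
        calc ‖x - y‖ = ‖-(u - x) + (u - v) + (v - y)‖ := by congr 1; abel
          _ ≤ ‖-(u - x) + (u - v)‖ + ‖v - y‖ := norm_add_le _ _
          _ ≤ ‖-(u - x)‖ + ‖u - v‖ + ‖v - y‖ := by gcongr; exact norm_add_le _ _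
          _ = _ := by rw [norm_neg]
      by_cases hux : d / 4 ≤ ‖u - x‖
      · refine le_trans ?_ (le_add_right (le_add_left le_rfl))
        rw [mul_assoc]
        gcongr
        exact hDle _ hux
      · push Not at hux
        have hvy : d / 4 ≤ ‖v - y‖ := by linarith
        refine le_trans ?_ (le_add_left le_rfl)
        rw [mul_comm (heatE r (u - x)), mul_assoc]
        gcongr
        exact hDle _ hvy
  have mx : Measurable fun u : E3 => heatE r (u - x) := (measurable_heatE r).comp (by fun_prop)
  have my : Measurable fun u : E3 => heatE r (u - y) := (measurable_heatE r).comp (by fun_prop)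
  have m2 : Measurable fun q : E3 × E3 => D * (heatE r (q.2 - y) * gb (q.1 - q.2)) :=
    ((my.comp measurable_snd).mul (hgbm.comp (measurable_fst.sub measurable_snd))).const_mul _
  have t1 : ∫⁻ u, ∫⁻ v, heatE r (u - x) * heatE r (v - y) * G = G := by
    have : ∀ u, ∫⁻ v, heatE r (u - x) * heatE r (v - y) * G = heatE r (u - x) * G := by
      intro u
      simp only [mul_assoc]
      rw [lintegral_const_mul' _ _ (by simp [heatE]), lintegral_mul_const' _ _ ENNReal.ofReal_ne_top,
        lintegral_heatE_sub hr, one_mul]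
    simp only [this]
    rw [lintegral_mul_const' _ _ ENNReal.ofReal_ne_top, lintegral_heatE_sub hr, one_mul]
  have t2 : ∫⁻ u, ∫⁻ v, D * (heatE r (v - y) * gb (u - v)) ≤ D * ENNReal.ofReal I := by
    rw [lintegral_lintegral_swap m2.aemeasurable]
    have : ∀ v, ∫⁻ u, D * (heatE r (v - y) * gb (u - v)) ≤
        heatE r (v - y) * (D * ENNReal.ofReal I) := by
      intro v
      rw [lintegral_const_mul' _ _ ENNReal.ofReal_ne_top, lintegral_const_mul' _ _ (by simp [heatE]),
        lintegral_sub_right_eq_self gb v, mul_left_comm]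
      gcongr
    refine (lintegral_mono this).trans (le_of_eq ?_)
    rw [lintegral_mul_const _ my, lintegral_heatE_sub hr, one_mul]
  have t3 : ∫⁻ u, ∫⁻ v, D * (heatE r (u - x) * gb (u - v)) ≤ D * ENNReal.ofReal I := by
    have : ∀ u, ∫⁻ v, D * (heatE r (u - x) * gb (u - v)) ≤
        heatE r (u - x) * (D * ENNReal.ofReal I) := by
      intro u
      rw [lintegral_const_mul' _ _ ENNReal.ofReal_ne_top, lintegral_const_mul' _ _ (by simp [heatE]),
        lintegral_sub_left_eq_self gb u, mul_left_comm]
      gcongr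
    refine (lintegral_mono this).trans (le_of_eq ?_)
    rw [lintegral_mul_const _ mx, lintegral_heatE_sub hr, one_mul]
  have hsplit : covDensity f r x y ≤ G + D * ENNReal.ofReal I + D * ENNReal.ofReal I := by
    unfold covDensity
    calc _ ≤ ∫⁻ u, ∫⁻ v, (heatE r (u - x) * heatE r (v - y) * G +
          D * (heatE r (v - y) * gb (u - v)) + D * (heatE r (u - x) * gb (u - v))) :=
          lintegral_mono fun u => lintegral_mono fun v => hpt u v
      _ = (∫⁻ u, ∫⁻ v, heatE r (u - x) * heatE r (v - y) * G) +
          (∫⁻ u, ∫⁻ v, D * (heatE r (v - y) * gb (u - v))) +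
          ∫⁻ u, ∫⁻ v, D * (heatE r (u - x) * gb (u - v)) := by
        have m1 : Measurable fun q : E3 × E3 => heatE r (q.1 - x) * heatE r (q.2 - y) * G :=
          ((mx.comp measurable_fst).mul (my.comp measurable_snd)).mul_const _
        have a1 := lintegral_lintegral_add (μ := volume) (ν := volume) m1
          fun q => D * (heatE r (q.2 - y) * gb (q.1 - q.2))
        have a2 := lintegral_lintegral_add (μ := volume) (ν := volume) (m1.add m2)
          fun q => D * (heatE r (q.1 - x) * gb (q.1 - q.2))
        simp only [Pi.add_apply] at a1 a2
        rw [a2, a1]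
      _ ≤ _ := by rw [t1]; gcongr
  refine hsplit.trans (le_of_eq ?_)
  rw [hG, hD, ← ENNReal.ofReal_mul (by positivity), ← ENNReal.ofReal_add (by positivity)
    (by positivity), ← ENNReal.ofReal_add (by positivity) (by positivity)]
  congr 1
  ring

end Correlation

/-! ### Integrating the covariance density in time -/

section TimeIntegrals

variable {α : ℝ} {f fhat : E3 → ℝ}

/-- An antiderivative is (α - 1)⁻¹ (-log r)^{1-α}, which tends to 0 at 0 exactly because α > 1. This
is what makes the variance finite. -/
lemma integrableOn_inv_mul_neg_log_rpow (hα : 1 < α) :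
    IntegrableOn (fun r : ℝ => r⁻¹ * (-Real.log r) ^ (-α)) (Ioc 0 (Real.exp (-2))) := by
  have hlog : ∀ x : ℝ, 0 < x → x ≤ Real.exp (-2) → 0 < -Real.log x := by
    intro x hx hx2
    have := Real.log_le_log hx hx2
    rw [Real.log_exp] at this
    linarith
  have hderiv : ∀ x : ℝ, 0 < x → x ≤ Real.exp (-2) →
      HasDerivAt (fun x => (α - 1)⁻¹ * (-Real.log x) ^ (1 - α))
        (x⁻¹ * (-Real.log x) ^ (-α)) x := by
    intro x hx hx2
    have h := (((Real.hasDerivAt_log hx.ne').neg).rpow_const (p := 1 - α)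
      (Or.inl (hlog x hx hx2).ne')).const_mul (α - 1)⁻¹
    refine h.congr_deriv ?_
    have : α - 1 ≠ 0 := by linarith
    rw [show 1 - α - 1 = -α by ring]
    simp only [Pi.neg_apply]
    field_simp
    ring
  refine intervalIntegral.integrableOn_deriv_of_nonneg
    (g := fun x => (α - 1)⁻¹ * (-Real.log x) ^ (1 - α)) ?_ ?_ ?_
  · intro x hx
    rcases hx.1.eq_or_lt with rfl | h0
    · rw [← continuousWithinAt_sdiff_self]
      have hg : Filter.Tendsto (fun x => (α - 1)⁻¹ * (-Real.log x) ^ (1 - α))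
          (nhdsWithin 0 (Ioi 0)) (nhds ((α - 1)⁻¹ * 0)) := by
        refine Filter.Tendsto.const_mul _ ?_
        have h1 : Filter.Tendsto (fun x => -Real.log x) (nhdsWithin 0 (Ioi 0)) Filter.atTop :=
          Filter.tendsto_neg_atBot_atTop.comp Real.tendsto_log_nhdsGT_zero
        have h2 := (tendsto_rpow_neg_atTop (y := α - 1) (by linarith)).comp h1
        simpa [Function.comp_def] using h2
      -- The conventions `Real.log 0 = 0` and `0 ^ (1 - α) = 0` happen to give the correct limit, so
      -- the antiderivative is continuous up to 0.
      have hz : (fun x => (α - 1)⁻¹ * (-Real.log x) ^ (1 - α)) 0 = (α - 1)⁻¹ * 0 := by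
        simp only [Real.log_zero, neg_zero]
        rw [Real.zero_rpow (by linarith)]
      unfold ContinuousWithinAt
      rw [hz]
      refine hg.mono_left (nhdsWithin_mono _ ?_)
      rintro y ⟨⟨hy0, -⟩, hy⟩
      exact lt_of_le_of_ne hy0 (Ne.symm hy)
    · exact (hderiv x h0 hx.2).continuousAt.continuousWithinAt
  · exact fun x hx => hderiv x hx.1 hx.2.le
  · intro x hx
    have := hlog x hx.1 hx.2.le
    have := hx.1
    positivity

/-- The variance of the solution is finite, uniformly in space. -/
lemma IsCorrelationFunction.exists_lintegral_covDensity_le (hf : IsCorrelationFunction α f fhat)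
    (hα : 1 < α) (t : ℝ) :
    ∃ v : ℝ, 0 < v ∧ ∀ x y : E3,
      ∫⁻ r in Ioo 0 t, covDensity f r x y ≤ ENNReal.ofReal v := by
  have hα0 : 0 < α := by linarith
  obtain ⟨C, hC, h1⟩ := hf.exists_covDensity_le_small hα0
  obtain ⟨C', hC', h2⟩ := hf.exists_covDensity_le_large hα0 (Real.exp_pos (-2))
  have hint := ((integrableOn_inv_mul_neg_log_rpow hα).mono_set Ioo_subset_Ioc_self).const_mul C
  set I : ℝ≥0∞ := ∫⁻ r in Ioo 0 (Real.exp (-2)),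
    ENNReal.ofReal (C * (r⁻¹ * (-Real.log r) ^ (-α))) with hI
  have hIfin : I < ∞ := hint.lintegral_lt_top
  have hfin : I + ENNReal.ofReal C' * volume (Ico (Real.exp (-2)) t) < ∞ := by
    rw [Real.volume_Ico]
    exact ENNReal.add_lt_top.2 ⟨hIfin, ENNReal.mul_lt_top ENNReal.ofReal_lt_top
      ENNReal.ofReal_lt_top⟩
  refine ⟨(I + ENNReal.ofReal C' * volume (Ico (Real.exp (-2)) t)).toReal + 1, by positivity,
    fun x y => ?_⟩
  have hsub : Ioo 0 t ⊆ Ioo 0 (Real.exp (-2)) ∪ Ico (Real.exp (-2)) t := by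
    intro r hr
    rcases lt_or_ge r (Real.exp (-2)) with h | h
    · exact Or.inl ⟨hr.1, h⟩
    · exact Or.inr ⟨h, hr.2⟩
  calc _ ≤ ∫⁻ r in Ioo 0 (Real.exp (-2)) ∪ Ico (Real.exp (-2)) t, covDensity f r x y :=
        lintegral_mono_set hsub
    _ ≤ (∫⁻ r in Ioo 0 (Real.exp (-2)), covDensity f r x y) +
        ∫⁻ r in Ico (Real.exp (-2)) t, covDensity f r x y := lintegral_union_le _ _ _
    _ ≤ I + ∫⁻ r in Ico (Real.exp (-2)) t, ENNReal.ofReal C' := by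
        refine add_le_add (setLIntegral_mono' measurableSet_Ioo fun r hr => h1 r hr.1 hr.2 x y)
          (setLIntegral_mono' measurableSet_Ico fun r hr => h2 r hr.1 x y)
    _ = I + ENNReal.ofReal C' * volume (Ico (Real.exp (-2)) t) := by rw [setLIntegral_const]
    _ ≤ _ := by
        rw [ENNReal.ofReal_add ENNReal.toReal_nonneg zero_le_one, ENNReal.ofReal_toReal hfin.ne]
        exact le_self_add

/-- Lower bound on the variance contributed by a short time interval. -/
lemma IsCorrelationFunction.exists_le_lintegral_covDensity (hf : IsCorrelationFunction α f fhat)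
    (hα : 1 < α) :
    ∃ c : ℝ, 0 < c ∧ ∀ ε : ℝ, 0 < ε → ε < Real.exp (-2) / 4 → ∀ x : E3,
      ENNReal.ofReal (c * (-Real.log ε) ^ (1 - α)) ≤ ∫⁻ r in Ioo 0 ε, covDensity f r x x := by
  obtain ⟨c, hc, h⟩ := hf.exists_le_covDensity (by linarith)
  refine ⟨c * 2 ^ (-α), by positivity, fun ε h0 h1 x => ?_⟩
  have he1 : ε < 1 := by
    have : Real.exp (-2) < 1 := by simp
    linarith
  have hlog : 0 < -Real.log ε := by linarith [Real.log_neg h0 he1]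
  have hε2 : ε ^ 2 ≤ ε := by nlinarith
  have hpos2 : 0 < ε ^ 2 := by positivity
  -- On (ε², ε) the logarithm varies by a factor at most 2 while dr/r has mass log(1/ε); this
  -- already yields the order (log 1/ε)^{1-α}.
  have hI : ∫⁻ r in Ioo (ε ^ 2) ε, ENNReal.ofReal r⁻¹ = ENNReal.ofReal (-Real.log ε) := by
    have hint : IntegrableOn (fun r : ℝ => r⁻¹) (Ioc (ε ^ 2) ε) := by
      refine (ContinuousOn.integrableOn_Icc ?_).mono_set Ioc_subset_Icc_self
      exact continuousOn_inv₀.mono fun r hr => (hpos2.trans_le hr.1).ne'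
    rw [← ofReal_integral_eq_lintegral_ofReal (hint.mono_set Ioo_subset_Ioc_self)
      (ae_restrict_of_forall_mem measurableSet_Ioo fun r hr => inv_nonneg.2 (hpos2.trans hr.1).le),
      ← integral_Ioc_eq_integral_Ioo, ← intervalIntegral.integral_of_le hε2,
      integral_inv_of_pos hpos2 h0]
    congr 1
    rw [Real.log_div h0.ne' hpos2.ne', Real.log_pow]
    push_cast; ring
  calc ENNReal.ofReal (c * 2 ^ (-α) * (-Real.log ε) ^ (1 - α))
      = ENNReal.ofReal (c * (2 * -Real.log ε) ^ (-α)) * ENNReal.ofReal (-Real.log ε) := by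
        rw [← ENNReal.ofReal_mul (by positivity)]
        congr 1
        rw [Real.mul_rpow (by norm_num) hlog.le, show (1 - α) = -α + 1 by ring,
          Real.rpow_add_one hlog.ne']
        ring
    _ = ∫⁻ r in Ioo (ε ^ 2) ε, ENNReal.ofReal (c * (2 * -Real.log ε) ^ (-α)) *
        ENNReal.ofReal r⁻¹ := by
        rw [lintegral_const_mul' _ _ ENNReal.ofReal_ne_top, hI]
    _ ≤ ∫⁻ r in Ioo (ε ^ 2) ε, covDensity f r x x := by
        refine setLIntegral_mono' measurableSet_Ioo fun r hr => ?_
        have hr0 : 0 < r := hpos2.trans hr.1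
        refine le_trans ?_ (h r hr0 (hr.2.trans h1) x)
        rw [← ENNReal.ofReal_mul (by positivity)]
        refine ENNReal.ofReal_le_ofReal ?_
        have hlr : 0 < -Real.log r := by linarith [Real.log_neg hr0 (hr.2.trans he1)]
        have : (2 * -Real.log ε) ^ (-α) ≤ (-Real.log r) ^ (-α) := by
          refine Real.rpow_le_rpow_of_nonpos hlr ?_ (by linarith)
          have := Real.log_le_log hpos2 hr.1.le
          rw [Real.log_pow] at this
          push_cast at this
          linarith
        have hr' : 0 ≤ r⁻¹ := by positivity
        calc _ = c * (r⁻¹ * (2 * -Real.log ε) ^ (-α)) := by ring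
          _ ≤ _ := by gcongr
    _ ≤ _ := lintegral_mono_set (Ioo_subset_Ioo_left hpos2.le)

/-- Off-diagonal covariances contributed by a short time interval. -/
lemma IsCorrelationFunction.exists_lintegral_covDensity_le_off
    (hf : IsCorrelationFunction α f fhat) (hα : 1 < α) :
    ∃ C : ℝ, 0 < C ∧ ∀ ε d : ℝ, 0 < ε → 0 < d → d ≤ 1 / 2 → ∀ x y : E3, d ≤ ‖x - y‖ →
      ∫⁻ r in Ioo 0 ε, covDensity f r x y ≤ ENNReal.ofReal (C * d ^ (-3 : ℝ) * ε) := by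
  obtain ⟨C, hC, h⟩ := hf.exists_covDensity_le_off (by linarith)
  refine ⟨C, hC, fun ε d h0 hd hd2 x y hxy => ?_⟩
  calc _ ≤ ∫⁻ r in Ioo 0 ε, ENNReal.ofReal (C * d ^ (-3 : ℝ)) :=
        setLIntegral_mono' measurableSet_Ioo fun r hr => h d hd hd2 r hr.1 x y hxy
    _ = _ := by
        rw [setLIntegral_const, Real.volume_Ioo, sub_zero, ← ENNReal.ofReal_mul (by positivity)]

end TimeIntegrals

/-! ### Covariances of the noise over time slabs -/

section Covariance

variable {α : ℝ} {f fhat : E3 → ℝ}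

/-- The heat kernel restricted to the last `a` units of time before `t`. -/
noncomputable def slabKernel (t a : ℝ) (x : E3) : ℝ × E3 → ℝ :=
  (Ioo (t - a) t ×ˢ univ).indicator fun q => heatKernel (t - q.1) (q.2 - x)

lemma measurable_slabKernel (t a : ℝ) (x : E3) : Measurable (slabKernel t a x) := by
  refine Measurable.indicator ?_ (measurableSet_Ioo.prod .univ)
  exact measurable_heatKernel_uncurry.comp
    ((measurable_const.sub measurable_fst).prodMk (measurable_snd.sub_const x))

lemma slabKernel_nonneg (t a : ℝ) (x : E3) (q : ℝ × E3) : 0 ≤ slabKernel t a x q :=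
  indicator_nonneg (fun _ hq => heatKernel_nonneg _ (sub_nonneg.2 hq.1.2.le) _) q

/-- The product of the two kernels lives on the shorter slab, so b disappears from the answer. The
condition a ≤ t keeps that slab within positive times, and r = t - s is the elapsed time. -/
lemma lintegral_slabKernel_mul {t a b : ℝ} (hab : a ≤ b) (ha : a ≤ t) (x z : E3) :
    ∫⁻ s in Ioi (0 : ℝ), ∫⁻ y : E3, ∫⁻ y' : E3,
      ENNReal.ofReal (slabKernel t a x (s, y) * slabKernel t b z (s, y') * f (y - y')) =
    ∫⁻ r in Ioo 0 a, covDensity f r x z := by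
  have hpt : ∀ s : ℝ, ∫⁻ y : E3, ∫⁻ y' : E3,
      ENNReal.ofReal (slabKernel t a x (s, y) * slabKernel t b z (s, y') * f (y - y')) =
      (Ioo 0 a).indicator (fun r => covDensity f r x z) (t - s) := by
    intro s
    by_cases hs : s ∈ Ioo (t - a) t
    · have hs' : t - s ∈ Ioo 0 a := ⟨by linarith [hs.2], by linarith [hs.1]⟩
      have hsb : s ∈ Ioo (t - b) t := ⟨by linarith [hs.1], hs.2⟩
      rw [indicator_of_mem hs', covDensity]
      refine lintegral_congr fun y => lintegral_congr fun y' => ?_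
      have e1 : slabKernel t a x (s, y) = heatKernel (t - s) (y - x) := by
        simp only [slabKernel, indicator, mem_prod, mem_univ, and_true, hs, if_true]
      have e2 : slabKernel t b z (s, y') = heatKernel (t - s) (y' - z) := by
        simp only [slabKernel, indicator, mem_prod, mem_univ, and_true, hsb, if_true]
      have n1 := heatKernel_nonneg (t - s) hs'.1.le (y - x)
      have n2 := heatKernel_nonneg (t - s) hs'.1.le (y' - z)
      rw [e1, e2, ENNReal.ofReal_mul (mul_nonneg n1 n2), ENNReal.ofReal_mul n1]
      rfl
    · have hs' : t - s ∉ Ioo 0 a := fun h => hs ⟨by linarith [h.2], by linarith [h.1]⟩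
      rw [indicator_of_notMem hs']
      simp [slabKernel, indicator, hs]
  simp only [hpt]
  rw [← lintegral_indicator measurableSet_Ioi, ← lintegral_indicator measurableSet_Ioo,
    ← lintegral_sub_left_eq_self _ t]
  refine lintegral_congr fun s => ?_
  by_cases hs : s ∈ Ioi (0 : ℝ)
  · have hs0 : 0 < s := hs
    by_cases hst : t - s ∈ Ioi (0 : ℝ)
    · rw [indicator_of_mem hst, sub_sub_cancel]
    · rw [indicator_of_notMem hst, indicator_of_notMem]
      exact fun h => hst (by simp only [mem_Ioi]; linarith [h.2, ha])
  · rw [indicator_of_notMem (s := Ioo 0 a) (fun h => hs h.1)]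
    by_cases hst : t - s ∈ Ioi (0 : ℝ)
    · rw [indicator_of_mem hst, sub_sub_cancel, indicator_of_notMem (fun h => hs h.1)]
    · rw [indicator_of_notMem hst]

/-- Passes from the Bochner integrals in the covariance of the noise to `lintegral`. Finiteness of
the triple integral gives almost everywhere finiteness of the inner ones, which `integral_toReal`
needs. -/
lemma integral_eq_toReal_lintegral_of_nonneg {h k : ℝ × E3 → ℝ} (hh : Measurable h)
    (hk : Measurable k) (h0 : ∀ q, 0 ≤ h q) (k0 : ∀ q, 0 ≤ k q) (hfm : Measurable f)
    (hf0 : ∀ x, x ≠ 0 → 0 ≤ f x)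
    (hfin : ∫⁻ s in Ioi (0 : ℝ), ∫⁻ y : E3, ∫⁻ y' : E3,
      ENNReal.ofReal (h (s, y) * k (s, y') * f (y - y')) < ∞) :
    ∫ s in Ioi (0 : ℝ), ∫ y : E3, ∫ y' : E3, h (s, y) * k (s, y') * f (y - y') =
      (∫⁻ s in Ioi (0 : ℝ), ∫⁻ y : E3, ∫⁻ y' : E3,
        ENNReal.ofReal (h (s, y) * k (s, y') * f (y - y'))).toReal := by
  have mF : Measurable fun q : (ℝ × E3) × E3 =>
      ENNReal.ofReal (h q.1 * k (q.1.1, q.2) * f (q.1.2 - q.2)) := by fun_prop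
  have mΦ : Measurable fun q : ℝ × E3 =>
      ∫⁻ y' : E3, ENNReal.ofReal (h q * k (q.1, y') * f (q.2 - y')) := mF.lintegral_prod_right'
  have mΨ : Measurable fun s : ℝ => ∫⁻ y : E3, ∫⁻ y' : E3,
      ENNReal.ofReal (h (s, y) * k (s, y') * f (y - y')) := mΦ.lintegral_prod_right'
  have inner : ∀ s y, ∫ y' : E3, h (s, y) * k (s, y') * f (y - y') =
      (∫⁻ y' : E3, ENNReal.ofReal (h (s, y) * k (s, y') * f (y - y'))).toReal := by
    intro s y
    refine integral_eq_lintegral_of_nonneg_ae ?_ (Measurable.aestronglyMeasurable (by fun_prop))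
    -- The sign of f at 0 is unknown, but y' = y is a null set.
    have hne : ∀ᵐ y' : E3, y' ≠ y := compl_mem_ae_iff.2 (measure_singleton y)
    filter_upwards [hne] with y' hy'
    exact mul_nonneg (mul_nonneg (h0 _) (k0 _)) (hf0 _ (sub_ne_zero.2 hy'.symm))
  simp only [inner]
  have hae := ae_lt_top mΨ hfin.ne
  rw [← integral_toReal mΨ.aemeasurable hae]
  refine integral_congr_ae ?_
  filter_upwards [hae] with s hs
  have ms : Measurable fun y : E3 =>
      ∫⁻ y' : E3, ENNReal.ofReal (h (s, y) * k (s, y') * f (y - y')) :=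
    mΦ.comp measurable_prodMk_left
  exact integral_toReal ms.aemeasurable (ae_lt_top ms hs.ne)

lemma IsCorrelationFunction.isIntegrand_slabKernel (hf : IsCorrelationFunction α f fhat)
    (hα : 1 < α) {t a : ℝ} (ha : a ≤ t) (x : E3) : IsIntegrand f (slabKernel t a x) := by
  refine ⟨measurable_slabKernel t a x, ?_⟩
  simp only [abs_of_nonneg (slabKernel_nonneg t a x _)]
  rw [lintegral_slabKernel_mul le_rfl ha]
  obtain ⟨v, -, hv⟩ := hf.exists_lintegral_covDensity_le hα a
  exact (hv x x).trans_lt ENNReal.ofReal_lt_top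

/-- Independence over disjoint times in covariance form: only the shorter slab counts, so the longer
slab minus the shorter is uncorrelated with the shorter. -/
lemma IsCorrelationFunction.cov_slabKernel (hf : IsCorrelationFunction α f fhat) (hα : 1 < α)
    {Ω : Type*} [MeasurableSpace Ω] {P : Measure Ω} {η : (ℝ × E3 → ℝ) → Ω → ℝ}
    (hη : IsNoise P f η) {t a b : ℝ} (hab : a ≤ b) (hb : b ≤ t) (x z : E3) :
    cov[η (slabKernel t a x), η (slabKernel t b z); P] =
      (∫⁻ r in Ioo 0 a, covDensity f r x z).toReal := by
  have ha : a ≤ t := hab.trans hb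
  obtain ⟨v, -, hv⟩ := hf.exists_lintegral_covDensity_le hα a
  rw [hη.covariance _ _ (hf.isIntegrand_slabKernel hα ha x) (hf.isIntegrand_slabKernel hα hb z),
    integral_eq_toReal_lintegral_of_nonneg (measurable_slabKernel t a x)
      (measurable_slabKernel t b z) (slabKernel_nonneg t a x) (slabKernel_nonneg t b z)
      hf.measurable fun x hx => (hf.pos x hx).le,
    lintegral_slabKernel_mul hab ha]
  rw [lintegral_slabKernel_mul hab ha]
  exact (hv x z).trans_lt ENNReal.ofReal_lt_top

end Covariance

/-! ### Lower tail over separated points and over fine grids -/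

section MainProof

variable {α : ℝ} {f fhat : E3 → ℝ}

/-- Translating both integration variables removes x, so the recent-noise variables share one
variance. -/
lemma covDensity_diag (r : ℝ) (x : E3) : covDensity f r x x = covDensity f r 0 0 := by
  unfold covDensity
  rw [← lintegral_add_right_eq_self _ x]
  refine lintegral_congr fun u => ?_
  rw [← lintegral_add_right_eq_self _ x]
  refine lintegral_congr fun v => ?_
  simp

lemma additiveSolution_eq {Ω : Type*} (η : (ℝ × E3 → ℝ) → Ω → ℝ) (t : ℝ) (x : E3) (ω : Ω) :
    additiveSolution η t x ω = 1 + η (slabKernel t t x) ω := by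
  simp [additiveSolution, slabKernel]

lemma le_norm_gridPoint_sub {N : ℕ} {i j : Fin 3 → Finset.Icc 1 N} (hij : i ≠ j) :
    (1 / N : ℝ) ≤ ‖gridPoint N i - gridPoint N j‖ := by
  obtain ⟨k, hk⟩ := Function.ne_iff.1 hij
  have hk' : ((i k : ℕ) : ℤ) - ((j k : ℕ) : ℤ) ≠ 0 := by
    intro h
    exact hk (Subtype.ext (by omega))
  have h1 : (1 : ℝ) ≤ |((i k : ℕ) : ℝ) - ((j k : ℕ) : ℝ)| := by
    have := Int.one_le_abs hk'
    exact_mod_cast this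
  have h2 := PiLp.norm_apply_le (gridPoint N i - gridPoint N j) k
  refine le_trans ?_ h2
  have h3 : (gridPoint N i - gridPoint N j) k = (((i k : ℕ) : ℝ) - ((j k : ℕ) : ℝ)) / N := by
    simp [gridPoint, sub_div]
  rw [h3, Real.norm_eq_abs, abs_div, Nat.abs_cast]
  gcongr

section Noise

variable {Ω : Type*} [MeasurableSpace Ω] {P : Measure Ω} {η : (ℝ × E3 → ℝ) → Ω → ℝ}

/-- Each member is a linear function of at most two values of the noise, so the decomposition
remains jointly Gaussian. -/
lemma IsNoise.isGaussianProcess_slab (hη : IsNoise P f η) {ι : Type*} {h k : ι → ℝ × E3 → ℝ}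
    (hh : ∀ i, IsIntegrand f (h i)) (hk : ∀ i, IsIntegrand f (k i)) :
    IsGaussianProcess (Sum.elim (fun i => η (h i) - η (k i)) fun i => η (k i)) P := by
  classical
  refine hη.isGaussianProcess.of_isGaussianProcess ?_
  rintro (i | i)
  · refine ⟨{⟨h i, hh i⟩, ⟨k i, hk i⟩},
      ContinuousLinearMap.proj ⟨⟨h i, hh i⟩, by simp⟩ -
        ContinuousLinearMap.proj ⟨⟨k i, hk i⟩, by simp⟩, fun ω => ?_⟩
    simp
  · refine ⟨{⟨k i, hk i⟩}, ContinuousLinearMap.proj ⟨⟨k i, hk i⟩, by simp⟩, fun ω => ?_⟩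
    simp

lemma IsNoise.hasGaussianLaw (hη : IsNoise P f η) {h : ℝ × E3 → ℝ} (hh : IsIntegrand f h) :
    HasGaussianLaw (η h) P :=
  hη.isGaussianProcess.hasGaussianLaw_eval ⟨h, hh⟩

/-- One-point bound: the solution is not close to zero with probability bounded below. -/
lemma IsCorrelationFunction.measureReal_abs_additiveSolution_le
    (hf : IsCorrelationFunction α f fhat) (hα : 1 < α) {t v : ℝ} (hv : 0 < v)
    (hvt : ∀ x y : E3, ∫⁻ r in Ioo 0 t, covDensity f r x y ≤ ENNReal.ofReal v)
    (hη : IsNoise P f η) (x : E3) :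
    P.real {ω | |additiveSolution η t x ω| ≤ 1 / 2} ≤ Real.exp (-(1 / (8 * v))) := by
  have hI := hf.isIntegrand_slabKernel hα (le_refl t) x
  have hG := hη.hasGaussianLaw hI
  have := hG.isProbabilityMeasure
  have hvar : Var[η (slabKernel t t x); P] ≤ v := by
    rw [← covariance_self hG.aemeasurable, hf.cov_slabKernel hα hη le_rfl le_rfl]
    exact ENNReal.toReal_le_of_le_ofReal hv.le (hvt x x)
  -- |1 + η| ≤ 1/2 forces η ≤ -1/2.
  have h := measureReal_le_neg_le hG (hη.centered _ hI) hv hvar (M := 1 / 2) (by norm_num)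
  calc _ ≤ P.real {ω | η (slabKernel t t x) ω ≤ -(1 / 2)} := by
        refine measureReal_mono fun ω hω => ?_
        have hω' : |additiveSolution η t x ω| ≤ 1 / 2 := hω
        rw [additiveSolution_eq] at hω'
        have := (abs_le.1 hω').2
        change η (slabKernel t t x) ω ≤ -(1 / 2)
        linarith
    _ ≤ _ := h
    _ = _ := by congr 2; field_simp; norm_num

/-- Lower tail of the maximum of the solution over a finite set of separated points. -/
lemma IsCorrelationFunction.measureReal_forall_additiveSolution_le
    (hf : IsCorrelationFunction α f fhat) (hα : 1 < α) {t v : ℝ} (hv : 0 < v)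
    (hvt : ∀ x y : E3, ∫⁻ r in Ioo 0 t, covDensity f r x y ≤ ENNReal.ofReal v)
    (hη : IsNoise P f η) {ι : Type*} [Fintype ι] [Nonempty ι] (p : ι → E3)
    {ε κ l M : ℝ} (hεt : ε ≤ t) (hκ : 0 ≤ κ)
    (hp : ∀ i j, i ≠ j → ∫⁻ r in Ioo 0 ε, covDensity f r (p i) (p j) ≤ ENNReal.ofReal κ)
    (hl : 0 < l) (hM : 0 ≤ M) :
    P.real {ω | ∀ i, additiveSolution η t (p i) ω ≤
        l * (∫⁻ r in Ioo 0 ε, covDensity f r 0 0).toReal / 2 - Real.log 4 / l - M} ≤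
      2 * Real.exp (-(M ^ 2 / (2 * v))) +
        16 * (Real.exp (l ^ 2 * (∫⁻ r in Ioo 0 ε, covDensity f r 0 0).toReal) / Fintype.card ι +
          (Real.exp (l ^ 2 * κ) - 1)) := by
  set δ := (∫⁻ r in Ioo 0 ε, covDensity f r 0 0).toReal with hδ
  have hY : ∀ i, IsIntegrand f (slabKernel t t (p i)) := fun i =>
    hf.isIntegrand_slabKernel hα le_rfl _
  have hB : ∀ i, IsIntegrand f (slabKernel t ε (p i)) := fun i =>
    hf.isIntegrand_slabKernel hα hεt _
  have gY := fun i => hη.hasGaussianLaw (hY i)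
  have gB := fun i => hη.hasGaussianLaw (hB i)
  have hG := hη.isGaussianProcess_slab hY hB
  have := hG.isProbabilityMeasure
  have cBB : ∀ i j, cov[η (slabKernel t ε (p i)), η (slabKernel t ε (p j)); P] =
      (∫⁻ r in Ioo 0 ε, covDensity f r (p i) (p j)).toReal := fun i j =>
    hf.cov_slabKernel hα hη le_rfl hεt _ _
  have cBY : ∀ i j, cov[η (slabKernel t ε (p i)), η (slabKernel t t (p j)); P] =
      (∫⁻ r in Ioo 0 ε, covDensity f r (p i) (p j)).toReal := fun i j =>
    hf.cov_slabKernel hα hη hεt le_rfl _ _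
  have cAB : ∀ i j, cov[η (slabKernel t t (p i)) - η (slabKernel t ε (p i)),
      η (slabKernel t ε (p j)); P] = 0 := by
    intro i j
    rw [covariance_sub_left (gY i).memLp_two (gB i).memLp_two (gB j).memLp_two,
      covariance_comm, covariance_comm (η (slabKernel t ε (p i))), cBB, cBY, sub_self]
  have vB : ∀ i, Var[η (slabKernel t ε (p i)); P] = δ := by
    intro i
    rw [← covariance_self (gB i).aemeasurable, cBB, hδ]
    simp only [covDensity_diag]
  have vA : ∀ i, Var[η (slabKernel t t (p i)) - η (slabKernel t ε (p i)); P] ≤ v := by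
    intro i
    -- Older and recent noise are uncorrelated, so Var A = Var Y - Var B ≤ Var Y, with Y the full
    -- noise integral.
    have h1 := variance_add ((gY i).memLp_two.sub (gB i).memLp_two) (gB i).memLp_two
    rw [sub_add_cancel, cAB] at h1
    have h2 : Var[η (slabKernel t t (p i)); P] ≤ v := by
      rw [← covariance_self (gY i).aemeasurable, hf.cov_slabKernel hα hη le_rfl le_rfl]
      exact ENNReal.toReal_le_of_le_ofReal hv.le (hvt _ _)
    have h3 := variance_nonneg (η (slabKernel t ε (p i))) P
    linarith
  have hA0 : ∀ i, P[η (slabKernel t t (p i)) - η (slabKernel t ε (p i))] = 0 := by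
    intro i
    rw [integral_sub' (gY i).integrable (gB i).integrable, hη.centered _ (hY i),
      hη.centered _ (hB i), sub_self]
  have hBB : ∀ i j, i ≠ j →
      cov[η (slabKernel t ε (p i)), η (slabKernel t ε (p j)); P] ≤ κ := by
    intro i j hij
    rw [cBB]
    exact ENNReal.toReal_le_of_le_ofReal hκ (hp i j hij)
  refine le_trans (measureReal_mono ?_) (measureReal_forall_add_le hG hA0
    (fun i => hη.centered _ (hB i)) cAB hκ hv vA vB hBB hl hM)
  -- The initial value 1 only helps: dropping it enlarges the event.
  intro ω hω i
  have h1 : additiveSolution η t (p i) ω ≤ l * δ / 2 - Real.log 4 / l - M := hω i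
  rw [additiveSolution_eq] at h1
  simp only [Pi.sub_apply]
  linarith

end Noise

/-- Lower tail of the maximum of the solution over a fine grid. -/
lemma IsCorrelationFunction.exists_measureReal_forall_gridPoint_le
    (hf : IsCorrelationFunction α f fhat) (hα₁ : 1 < α) (hα₂ : α < 2) {t : ℝ} (ht : 0 < t) :
    ∃ b k : ℝ, 0 < b ∧ 0 < k ∧ ∃ N₀ : ℕ, ∀ N : ℕ, N₀ ≤ N →
      ∀ (Ω : Type*) [MeasurableSpace Ω] (P : Measure Ω) (η : (ℝ × E3 → ℝ) → Ω → ℝ),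
        IsNoise P f η →
        P.real {ω | ∀ j : Fin 3 → Finset.Icc 1 N, additiveSolution η t (gridPoint N j) ω ≤
            k * Real.log N ^ (1 - α / 2)} ≤
          Real.exp (-(b * Real.log N ^ (2 - α))) := by
  obtain ⟨v, hv, hvt⟩ := hf.exists_lintegral_covDensity_le hα₁ t
  obtain ⟨c, hc, hlow⟩ := hf.exists_le_lintegral_covDensity hα₁
  obtain ⟨C, hC, hoff⟩ := hf.exists_lintegral_covDensity_le_off hα₁
  -- The factor 5^{1-α} comes from -log ε = 5 log N for ε = N⁻⁵.
  set c₁ := c * 5 ^ (1 - α) with hc₁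
  have hc₁0 : 0 < c₁ := by positivity
  set C₂ := 3 * C / (2 * c₁) with hC₂
  have hC₂0 : 0 < C₂ := by positivity
  -- With M = lδ/8 and (lδ)² = (3/2) δ log N, M²/(2v) = 3 δ log N / (256 v). The cap at 1 lets
  -- exp(-b (log N)^{2-α}) dominate the errors of order N⁻¹.
  set b := min (3 * c₁ / (256 * v)) 1 with hb
  have hb0 : 0 < b := lt_min (by positivity) one_pos
  -- Half of b is given up to absorb the prefactor. The 1/4 is 1/2 - 1/8 - 1/8, after subtracting
  -- log 4 / l ≤ lδ/8 and M = lδ/8.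
  refine ⟨b / 2, √(3 * c₁ / 2) / 4, by positivity, by positivity, ?_⟩
  have tlog : Filter.Tendsto (fun N : ℕ => Real.log N) Filter.atTop Filter.atTop :=
    Real.tendsto_log_atTop.comp tendsto_natCast_atTop_atTop
  have tL : Filter.Tendsto (fun N : ℕ => Real.exp (b / 2 * Real.log N ^ (2 - α)))
      Filter.atTop Filter.atTop :=
    Real.tendsto_exp_atTop.comp (Filter.Tendsto.const_mul_atTop (by positivity)
      ((tendsto_rpow_atTop (by linarith)).comp tlog))
  have tε : Filter.Tendsto (fun N : ℕ => Real.exp (-(5 * Real.log N)))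
      Filter.atTop (nhds 0) :=
    Real.tendsto_exp_neg_atTop_nhds_zero.comp (tlog.const_mul_atTop (by norm_num))
  have tN : Filter.Tendsto (fun N : ℕ => 4 * C₂ * Real.exp (-Real.log N))
      Filter.atTop (nhds (4 * C₂ * 0)) :=
    (Real.tendsto_exp_neg_atTop_nhds_zero.comp tlog).const_mul _
  rw [mul_zero] at tN
  -- log N ≥ 8 ensures log 4 ≤ l²δ/8 = (3/16) log N.
  have hev := (tlog.eventually_ge_atTop 8).and ((tL.eventually_ge_atTop (18 + 128 * C₂)).and
    ((tε.eventually_lt_const ht).and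
    ((tε.eventually_lt_const (show 0 < Real.exp (-2) / 4 by positivity)).and
    (tN.eventually_lt_const one_pos))))
  obtain ⟨N₀, hN₀⟩ := Filter.eventually_atTop.1 hev
  refine ⟨N₀, fun N hN Ω _ P η hη => ?_⟩
  obtain ⟨hl8, hL, hεt, hε2, hN1⟩ := hN₀ N hN
  set ℓ := Real.log N with hℓ
  have hℓ0 : 0 < ℓ := by linarith
  have hN0 : (0 : ℝ) < N := by
    rcases Nat.eq_zero_or_pos N with h | h
    · simp [hℓ, h] at hℓ0
    · exact_mod_cast h
  have hNexp : (N : ℝ) = Real.exp ℓ := (Real.exp_log hN0).symm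
  have hN2 : (2 : ℝ) ≤ N := by
    rw [hNexp]; linarith [Real.add_one_le_exp ℓ]
  set ε := Real.exp (-(5 * ℓ)) with hε
  have hε0 : 0 < ε := Real.exp_pos _
  have hfin : ∫⁻ r in Ioo 0 ε, covDensity f r 0 0 ≠ ∞ :=
    ((lintegral_mono_set (Ioo_subset_Ioo_right hεt.le)).trans (hvt 0 0)).trans_lt
      ENNReal.ofReal_lt_top |>.ne
  set δ := (∫⁻ r in Ioo 0 ε, covDensity f r 0 0).toReal with hδ
  have hδlow : c₁ * ℓ ^ (1 - α) ≤ δ := by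
    have h := hlow ε hε0 hε2 0
    rw [ENNReal.ofReal_le_iff_le_toReal hfin, hε, Real.log_exp, neg_neg,
      Real.mul_rpow (by norm_num) hℓ0.le, ← hε] at h
    rw [hc₁]; linarith
  have hδ0 : 0 < δ := lt_of_lt_of_le (by positivity) hδlow
  set κ := C * Real.exp (-(2 * ℓ)) with hκ
  have hκ0 : 0 < κ := by positivity
  have hκoff : ∀ i j : Fin 3 → Finset.Icc 1 N, i ≠ j →
      ∫⁻ r in Ioo 0 ε, covDensity f r (gridPoint N i) (gridPoint N j) ≤ ENNReal.ofReal κ := by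
    intro i j hij
    refine (hoff ε (1 / N) hε0 (by positivity) (by gcongr) _ _
      (le_norm_gridPoint_sub hij)).trans (le_of_eq ?_)
    congr 1
    rw [hκ, hNexp, one_div, ← Real.exp_neg, ← Real.exp_mul, hε, mul_assoc, ← Real.exp_add]
    ring_nf
  -- Then l²δ is half of log n = 3 log N, so exp(l²δ)/n = N^{-3/2} while lδ keeps the order √(δ log
  -- N).
  set l := √(3 * ℓ / (2 * δ)) with hl
  have hl0 : 0 < l := Real.sqrt_pos.2 (by positivity)
  have hl2 : l ^ 2 = 3 * ℓ / (2 * δ) := Real.sq_sqrt (by positivity)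
  have hl2δ : l ^ 2 * δ = 3 / 2 * ℓ := by rw [hl2]; field_simp
  have hne : Nonempty (Fin 3 → Finset.Icc 1 N) :=
    ⟨fun _ => ⟨1, Finset.mem_Icc.2 ⟨le_rfl, by exact_mod_cast (by linarith : (1 : ℝ) ≤ N)⟩⟩⟩
  have hcard : (Fintype.card (Fin 3 → Finset.Icc 1 N) : ℝ) = Real.exp (3 * ℓ) := by
    simp only [Fintype.card_fun, Fintype.card_coe, Nat.card_Icc, Fintype.card_fin,
      add_tsub_cancel_right]
    push_cast
    rw [hNexp, ← Real.exp_nat_mul]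
    norm_num
  set L := ℓ ^ (2 - α) with hLdef
  have hL0 : 0 < L := by positivity
  have hLmul : ℓ ^ (1 - α) * ℓ = L := by
    rw [hLdef, ← Real.rpow_add_one hℓ0.ne']; ring_nf
  have hδℓ : c₁ * L ≤ δ * ℓ := by
    rw [← hLmul, ← mul_assoc]; gcongr
  have hlδ2 : (l * δ) ^ 2 = 3 / 2 * (δ * ℓ) := by
    rw [mul_pow, sq δ, ← mul_assoc, hl2δ]; ring
  have hthr : √(3 * c₁ / 2) / 4 * ℓ ^ (1 - α / 2) ≤
      l * δ / 2 - Real.log 4 / l - l * δ / 8 := by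
    have h1 : √(3 * c₁ / 2) * ℓ ^ (1 - α / 2) ≤ l * δ := by
      refine abs_le_of_sq_le_sq' ?_ (by positivity) |>.2
      rw [hlδ2, mul_pow, Real.sq_sqrt (by positivity), ← Real.rpow_natCast,
        ← Real.rpow_mul hℓ0.le]
      have : (1 - α / 2) * ((2 : ℕ) : ℝ) = 2 - α := by push_cast; ring
      rw [this, ← hLdef]
      linarith
    have h2 : Real.log 4 / l ≤ l * δ / 8 := by
      rw [div_le_iff₀ hl0]
      have : l * δ / 8 * l = l ^ 2 * δ / 8 := by ring
      rw [this, hl2δ, show (4 : ℝ) = 2 ^ 2 by norm_num, Real.log_pow]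
      push_cast
      linarith [Real.log_two_lt_d9]
    linarith
  have hmain := hf.measureReal_forall_additiveSolution_le hα₁ hv hvt hη (gridPoint N) hεt.le
    hκ0.le hκoff hl0 (M := l * δ / 8) (by positivity)
  have : IsProbabilityMeasure P :=
    (hη.hasGaussianLaw (hf.isIntegrand_slabKernel hα₁ (le_refl t) 0)).isProbabilityMeasure
  have e1 : Real.exp (-((l * δ / 8) ^ 2 / (2 * v))) ≤ Real.exp (-(b * L)) := by
    refine Real.exp_le_exp.2 (neg_le_neg ?_)
    have : (l * δ / 8) ^ 2 / (2 * v) = 3 * (δ * ℓ) / (256 * v) := by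
      rw [div_pow, hlδ2]; field_simp; norm_num
    rw [this]
    calc b * L ≤ 3 * c₁ / (256 * v) * L := by gcongr; exact min_le_left _ _
      _ = 3 * (c₁ * L) / (256 * v) := by ring
      _ ≤ _ := by gcongr
  have e0 : Real.exp (-ℓ) ≤ Real.exp (-(b * L)) := by
    refine Real.exp_le_exp.2 (neg_le_neg ?_)
    calc b * L ≤ 1 * L := by gcongr; exact min_le_right _ _
      _ = ℓ ^ (2 - α) := one_mul _
      _ ≤ ℓ ^ (1 : ℝ) := Real.rpow_le_rpow_of_exponent_le (by linarith) (by linarith)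
      _ = ℓ := Real.rpow_one _
  have e2 : Real.exp (l ^ 2 * δ) / Fintype.card (Fin 3 → Finset.Icc 1 N) ≤
      Real.exp (-(b * L)) := by
    rw [hcard, hl2δ, ← Real.exp_sub]
    exact (Real.exp_le_exp.2 (by linarith)).trans e0
  have e3 : Real.exp (l ^ 2 * κ) - 1 ≤ 8 * C₂ * Real.exp (-(b * L)) := by
    have h1 : l ^ 2 * κ ≤ 4 * C₂ * Real.exp (-ℓ) := by
      have hα' : ℓ ^ α ≤ ℓ ^ 2 := by
        rw [← Real.rpow_natCast]
        exact Real.rpow_le_rpow_of_exponent_le (by linarith) (by push_cast; linarith)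
      have hsq : ℓ ^ 2 ≤ 4 * Real.exp ℓ := by
        have := Real.quadratic_le_exp_of_nonneg hℓ0.le
        nlinarith
      have h2 : ℓ / δ ≤ ℓ ^ α / c₁ := by
        rw [div_le_div_iff₀ hδ0 hc₁0]
        have h3 : ℓ ^ α * (c₁ * ℓ ^ (1 - α)) ≤ ℓ ^ α * δ := by gcongr
        have h4 : ℓ ^ α * ℓ ^ (1 - α) = ℓ := by
          rw [← Real.rpow_add hℓ0]; simp
        calc ℓ * c₁ = ℓ ^ α * ℓ ^ (1 - α) * c₁ := by rw [h4]
          _ = ℓ ^ α * (c₁ * ℓ ^ (1 - α)) := by ring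
          _ ≤ _ := h3
      have h5 : ℓ / δ ≤ 4 * Real.exp ℓ / c₁ :=
        h2.trans (div_le_div_of_nonneg_right (hα'.trans hsq) hc₁0.le)
      calc l ^ 2 * κ = 3 * C / 2 * (ℓ / δ) * Real.exp (-(2 * ℓ)) := by rw [hl2, hκ]; ring
        _ ≤ 3 * C / 2 * (4 * Real.exp ℓ / c₁) * Real.exp (-(2 * ℓ)) := by
          exact mul_le_mul_of_nonneg_right
            (mul_le_mul_of_nonneg_left h5 (by positivity)) (Real.exp_pos _).le
        _ = 4 * C₂ * (Real.exp ℓ * Real.exp (-(2 * ℓ))) := by rw [hC₂]; field_simp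
        _ = _ := by rw [← Real.exp_add]; ring_nf
    have h0 : 0 ≤ l ^ 2 * κ := by positivity
    -- |e^x - 1| ≤ 2|x| requires |x| ≤ 1, which holds because 4 C₂ / N < 1.
    have h2 := Real.abs_exp_sub_one_le (x := l ^ 2 * κ)
      (by rw [abs_of_nonneg h0]; linarith)
    rw [abs_of_nonneg h0] at h2
    have h3 := (le_abs_self _).trans h2
    have h4 : 8 * C₂ * Real.exp (-ℓ) ≤ 8 * C₂ * Real.exp (-(b * L)) := by gcongr
    linarith
  calc _ ≤ P.real {ω | ∀ j, additiveSolution η t (gridPoint N j) ω ≤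
        l * δ / 2 - Real.log 4 / l - l * δ / 8} :=
        measureReal_mono fun ω hω j => (hω j).trans hthr
    _ ≤ _ := hmain
    _ ≤ 2 * Real.exp (-(b * L)) + 16 * (Real.exp (-(b * L)) + 8 * C₂ * Real.exp (-(b * L))) := by
        gcongr
    _ = (18 + 128 * C₂) * Real.exp (-(b * L)) := by ring
    _ ≤ Real.exp (b / 2 * L) * Real.exp (-(b * L)) := by gcongr
    _ = Real.exp (-(b / 2 * L)) := by rw [← Real.exp_add]; ring_nf

end MainProof

end SHE

/-! ### One constant for every N -/

theorem mainTheorem6 (α : ℝ) (hα₁ : 1 < α) (hα₂ : α < 2)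
    (f fhat : SHE.E3 → ℝ) (hf : SHE.IsCorrelationFunction α f fhat) (t : ℝ) (ht : 0 < t) :
    ∃ K : ℝ, 1 < K ∧
      ∀ (Ω : Type*) [MeasurableSpace Ω] (P : Measure Ω) [IsProbabilityMeasure P]
        (η : (ℝ × SHE.E3 → ℝ) → Ω → ℝ), SHE.IsNoise P f η →
        ∀ N : ℕ, 1 ≤ N →
          P.real {ω | (⨆ j : Fin 3 → Finset.Icc 1 N,
              |SHE.additiveSolution η t (SHE.gridPoint N j) ω|) ≤
                1 / K * Real.log N ^ (1 - α / 2)} ≤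
            Real.exp (-(Real.log N ^ (2 - α) / (K ^ 2 * (1 + t)))) := by
  obtain ⟨v, hv, hvt⟩ := hf.exists_lintegral_covDensity_le hα₁ t
  obtain ⟨b, k, hb, hk, N₀, hN₀⟩ := hf.exists_measureReal_forall_gridPoint_le hα₁ hα₂ ht
  set ℓ₀ := Real.log (N₀ + 1 : ℕ) with hℓ₀
  have hℓ₀0 : 0 ≤ ℓ₀ := Real.log_natCast_nonneg _
  -- k⁻¹ and b⁻¹ serve large N: 1/K ≤ k and 1/(K²(1+t)) ≤ b. The last two terms serve N < N₀: they
  -- bring the threshold below 1/2 and the exponent below 1/(8v).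
  set K := 2 + k⁻¹ + b⁻¹ + 2 * ℓ₀ ^ (1 - α / 2) + 8 * v * ℓ₀ ^ (2 - α) with hK
  have q1 : 0 < k⁻¹ := by positivity
  have q2 : 0 < b⁻¹ := by positivity
  have q3 : 0 ≤ 2 * ℓ₀ ^ (1 - α / 2) := by positivity
  have q4 : 0 ≤ 8 * v * ℓ₀ ^ (2 - α) := by positivity
  have hK1 : 1 < K := by linarith
  have hK0 : 0 < K := by linarith
  have hKsq : K ≤ K ^ 2 * (1 + t) := by nlinarith [mul_pos (pow_pos hK0 2) ht]
  refine ⟨K, hK1, fun Ω _ P _ η hη N hN => ?_⟩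
  have hℓ : 0 ≤ Real.log N := Real.log_natCast_nonneg _
  have hsup : ∀ ω, (⨆ j : Fin 3 → Finset.Icc 1 N,
      |SHE.additiveSolution η t (SHE.gridPoint N j) ω|) ≤ 1 / K * Real.log N ^ (1 - α / 2) →
      ∀ j : Fin 3 → Finset.Icc 1 N, |SHE.additiveSolution η t (SHE.gridPoint N j) ω| ≤
        1 / K * Real.log N ^ (1 - α / 2) := fun ω hω j =>
    (le_ciSup (f := fun j => |SHE.additiveSolution η t (SHE.gridPoint N j) ω|)
      (Set.finite_range _).bddAbove j).trans hω
  rcases le_or_gt N₀ N with hNN | hNN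
  · refine (measureReal_mono fun ω hω j => ?_).trans ((hN₀ N hNN Ω P η hη).trans ?_)
    · refine (le_abs_self _).trans ((hsup ω hω j).trans ?_)
      have : 1 / K ≤ k := by
        rw [one_div]; exact inv_le_of_inv_le₀ hk (by linarith)
      gcongr
    · refine Real.exp_le_exp.2 (neg_le_neg ?_)
      rw [div_le_iff₀ (by positivity)]
      have : 1 ≤ b * (K ^ 2 * (1 + t)) := by
        have h1 : b⁻¹ ≤ K ^ 2 * (1 + t) := by linarith
        rwa [inv_le_iff_one_le_mul₀' hb] at h1
      have h0 : 0 ≤ Real.log N ^ (2 - α) := by positivity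
      nlinarith
  -- For these N the logarithm is bounded, and the one-point estimate at a single grid point is
  -- enough.
  · have hlog : Real.log N ≤ ℓ₀ :=
      Real.log_le_log (by exact_mod_cast hN) (by exact_mod_cast (by omega : N ≤ N₀ + 1))
    have j₀ : Fin 3 → Finset.Icc 1 N := fun _ => ⟨1, Finset.mem_Icc.2 ⟨le_rfl, hN⟩⟩
    refine (measureReal_mono fun ω hω => ?_).trans
      ((hf.measureReal_abs_additiveSolution_le hα₁ hv hvt hη (SHE.gridPoint N j₀)).trans ?_)
    · refine (hsup ω hω j₀).trans ?_
      have h1 : Real.log N ^ (1 - α / 2) ≤ ℓ₀ ^ (1 - α / 2) :=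
        Real.rpow_le_rpow hℓ hlog (by linarith)
      rw [one_div, inv_mul_le_iff₀ hK0]
      linarith
    · refine Real.exp_le_exp.2 (neg_le_neg ?_)
      have h1 : Real.log N ^ (2 - α) ≤ ℓ₀ ^ (2 - α) :=
        Real.rpow_le_rpow hℓ hlog (by linarith)
      rw [div_le_div_iff₀ (by positivity) (by positivity)]
      nlinarith
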